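/- Let $X$ and $Y$ be random variables with finite alphabets $\mathcal X,\mathcal Y$ and let $Z$ be a discrete random variable, with joint distribution $P_{XYZ}$. All random variables below are discrete. For real $\alpha'\in(1,\infty)$ and jointly distributed $U,Y,Z$ put $$\mathcal L_{\alpha'}(U\to Y)=\frac{\alpha'}{\alpha'-1}\log\frac{\max_{P_{\hat U|Y}}\mathbb E\big[P_{\hat U|Y}(U|Y)^{\frac{\alpha'-1}{\alpha'}}\big]}{\max_{P_{\hat U}}\mathbb E\big[P_{\hat U}(U)^{\frac{\alpha'-1}{\alpha'}}\big]},\qquad \mathcal L_{\alpha'}(U\to Y|Z)=\frac{\alpha'}{\alpha'-1}\log\frac{\max_{P_{\hat U|Y,Z}}\mathbb E\big[P_{\hat U|Y,Z}(U|Y,Z)^{\frac{\alpha'-1}{\alpha'}}\big]}{\max_{P_{\hat U|Z}}\mathbb E\big[P_{\hat U|Z}(U|Z)^{\frac{\alpha'-1}{\alpha'}}\big]},$$ where the maxima are over all (conditional) distributions on the alphabet of $U$; for $\alpha\in\{1,\infty\}$ the quantity $\mathcal L_\alpha(U\to Y|Z)$ is defined by continuous extension, that is, as the limit for $\alpha'\to\alpha$,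 $\alpha'\in(1,\infty)$. For $\alpha\in[1,\infty]$ define the maximal $\alpha$-leakage from $X$ to $Y$ and the conditional maximal $\alpha$-leakage from $X$ to $Y$ given $Z$ by $$\mathcal L_\alpha^{\max}(X\to Y)=\sup_{U:\,U-X-Y}\ \lim_{\alpha'\to\alpha}\mathcal L_{\alpha'}(U\to Y),\qquad \mathcal L_\alpha^{\max}(X\to Y|Z)=\sup_{U:\,U-(X,Z)-Y}\mathcal L_\alpha(U\to Y|Z),$$ where $U$ takes values in an arbitrary alphabet, $\alpha'$ ranges over $(1,\infty)$, and $A-B-C$ means that $A,B,C$ form a Markov chain ($A$ and $C$ are conditionally independent given $B$). If $Z-X-Y$ is a Markov chain, then for every $\alpha\in[1,\infty]$ $$\mathcal L_\alpha^{\max}(X\to Y|Z)\le\mathcal L_\alpha^{\max}(X\to Y).$$ -/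

import Mathlib

open scoped ENNReal Topology

namespace AlphaLeakage

noncomputable section

/-- For a joint law `Q` of three discrete random variables `(A, B, C)`: the Markov chain
`A - B - C`, i.e. `P(a,b,c) P(b) = P(a,b) P(b,c)` for all `a, b, c`. -/
def IsMarkovChain {A B C : Type*} (Q : PMF (A × B × C)) : Prop :=
  ∀ (a : A) (b : B) (c : C),
    Q (a, b, c) * (Q.map fun p => p.2.1) b
      = (Q.map fun p => (p.1, p.2.1)) (a, b) * (Q.map fun p => p.2) (b, c)

/-- `max_{P_Û} E[P_Û(U) ^ β]`, where `U` has law `Q` and `P_Û` ranges over all distributions on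
the alphabet of `U`. -/
def maxGain {U : Type*} (Q : PMF U) (β : ℝ) : ℝ≥0∞ :=
  ⨆ K : PMF U, ∑' u : U, Q u * K u ^ β

/-- `max_{P_Û|S} E[P_Û|S(U|S) ^ β]`, where `(U, S)` has joint law `Q` and `P_Û|S` ranges over all
conditional distributions on the alphabet of `U` given the observation `S`. -/
def condMaxGain {U S : Type*} (Q : PMF (U × S)) (β : ℝ) : ℝ≥0∞ :=
  ⨆ K : S → PMF U, ∑' p : U × S, Q p * K p.2 p.1 ^ β

/-- The `α`-leakage from `U` to `Y` for real `1 < α < ∞`, where `(U, Y)` has joint law `Q`. -/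
def leakageReal {U Y : Type*} (Q : PMF (U × Y)) (α : ℝ) : EReal :=
  ((α / (α - 1) : ℝ) : EReal) *
    ENNReal.log (condMaxGain Q ((α - 1) / α) / maxGain (Q.map Prod.fst) ((α - 1) / α))

/-- The `α`-leakage from `U` to `Y` given `Z` for real `1 < α < ∞`, where `(U, Y, Z)` has joint
law `Q`: in the numerator the guesser observes `(Y, Z)`, in the denominator only `Z`. -/
def condLeakageReal {U Y Z : Type*} (Q : PMF (U × Y × Z)) (α : ℝ) : EReal :=
  ((α / (α - 1) : ℝ) : EReal) *
    ENNReal.log (condMaxGain Q ((α - 1) / α) /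
      condMaxGain (Q.map fun p => (p.1, p.2.2)) ((α - 1) / α))

/-- The filter of the limit `α' → α`, where the real orders `α'` run through `(1, ∞)`, `α' ≠ α`,
and `α ∈ [1, ∞]`. -/
def orderFilter (α : ℝ≥0∞) : Filter ℝ :=
  if α = ⊤ then Filter.atTop else 𝓝[Set.Ioi 1 \ {α.toReal}] α.toReal

/-- Conditional `α`-leakage from `U` to `Y` given `Z` for `α ∈ [1, ∞]`: the formula for
`1 < α < ∞`, continuously extended to `α = 1` and `α = ∞`. -/
def condLeakage {U Y Z : Type*} (Q : PMF (U × Y × Z)) (α : ℝ≥0∞) : EReal :=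
  if 1 < α ∧ α < ⊤ then condLeakageReal Q α.toReal
  else Filter.limUnder (orderFilter α) (condLeakageReal Q)

/-- Maximal `α`-leakage from `X` to `Y`, where `(X, Y)` has joint law `P`: the supremum over all
discrete `U` (on an arbitrary alphabet) with `U - X - Y` of the limit, as `α' → α`, of the
`α'`-leakage from `U` to `Y`. A `PMF` has countable support, so it is no restriction that the
alphabets lie in `Type`. -/
def maxLeakage {X Y : Type*} (P : PMF (X × Y)) (α : ℝ≥0∞) : EReal :=
  ⨆ (U : Type) (Q : PMF (U × X × Y)) (_ : Q.map Prod.snd = P) (_ : IsMarkovChain Q),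
    Filter.limUnder (orderFilter α) (leakageReal (Q.map fun p => (p.1, p.2.2)))

/-- Conditional maximal `α`-leakage from `X` to `Y` given `Z`, where `(X, Y, Z)` has joint law
`P`: the supremum over all discrete `U` (on an arbitrary alphabet) with `U - X - Y | Z`, i.e.
`U - (X, Z) - Y`, of the conditional `α`-leakage from `U` to `Y` given `Z`. -/
def condMaxLeakage {X Y Z : Type*} (P : PMF (X × Y × Z)) (α : ℝ≥0∞) : EReal :=
  ⨆ (U : Type) (Q : PMF (U × X × Y × Z)) (_ : Q.map Prod.snd = P)
    (_ : IsMarkovChain (Q.map fun p => (p.1, (p.2.1, p.2.2.2), p.2.2.1))),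
    condLeakage (Q.map fun p => (p.1, p.2.2.1, p.2.2.2)) α

end

end AlphaLeakage

namespace AlphaLeakage

/-! By Hölder, the best guessing gain with exponent `(a - 1) / a` is a sum of `ℓ^a` norms over the
observations, so leakages compare such norms (`condMaxGain_eq`, `maxGain_eq`). The Markov conditions
give P(u,x,y,z) = V_z(u,x) W(y|x), where V_z(u,x) = P(u,x,z) and W is the channel from X to Y
(`apply_eq_mul_channel`). Thus each slice z feeds a part of the law of X, split by U, through the
same W.

For 1 < α < ∞ it suffices to bound the gain ratio of a single slice by the constant C that the
maximal leakage provides, and then to sum over z. A slice has too little mass to be a law of (U, X),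
so the missing mass is spread evenly over N + 1 new symbols. These can only raise the numerator, and
their contribution to the denominator vanishes as N → ∞ because α > 1
(`tsum_lpNorm_le_of_maxLeakage`).

For α = ∞ both sides are compared with log Σ_y max_x W(y|x). It bounds the conditional leakage up to
the factor a / (a - 1), and it is approached from X to Y by a U that cuts the law of X into pieces
of nearly negligible mass variation: one piece of equal mass per value of X, and fillers no heavier
(`log_iSup_channel_le_maxLeakage`).

For α = 1 the leakages tend to mutual informations (`tendsto_leakage_one`). Superadditivity of the
mass-weighted entropy gives I(U;Y|Z) ≤ I(X;Y) (`tsum_massEntropy_sub_le`), and U = X attains I(X;Y).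
-/

open Filter

/-! ### Optimal gains as `ℓ^a` norms. -/

/-- The `ℓ^a` quasi-norm of an extended nonnegative family. -/
noncomputable def lpNorm {U : Type*} (a : ℝ) (f : U → ℝ≥0∞) : ℝ≥0∞ := (∑' u, f u ^ a) ^ (1 / a)

theorem holderConjugate_of_one_lt {a : ℝ} (ha : 1 < a) : a.HolderConjugate (a / (a - 1)) :=
  Real.HolderConjugate.conjExponent ha

/-- Hölder with exponents a and a / (a - 1): the second one turns the weights `k ^ ((a - 1) / a)`
back into `k`, of mass at most one. -/
theorem tsum_mul_rpow_le_lpNorm {U : Type*} {a : ℝ} (ha : 1 < a) (f k : U → ℝ≥0∞)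
    (hk : ∑' u, k u ≤ 1) : ∑' u, f u * k u ^ ((a - 1) / a) ≤ lpNorm a f := by
  have h0 : 0 < a := by linarith
  have h1 : 0 < a - 1 := by linarith
  rw [ENNReal.tsum_eq_iSup_sum]
  refine iSup_le fun s => ?_
  refine (ENNReal.inner_le_Lp_mul_Lq s f _ (holderConjugate_of_one_lt ha)).trans ?_
  have hsum : ∑ i ∈ s, (k i ^ ((a - 1) / a)) ^ (a / (a - 1)) ≤ 1 := by
    refine le_trans (le_of_eq ?_) ((ENNReal.sum_le_tsum s).trans hk)
    refine Finset.sum_congr rfl fun i _ => ?_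
    rw [← ENNReal.rpow_mul, show (a - 1) / a * (a / (a - 1)) = 1 by field_simp, ENNReal.rpow_one]
  calc _ ≤ (∑' u, f u ^ a) ^ (1 / a) * 1 ^ (1 / (a / (a - 1))) := by
        gcongr
        exact ENNReal.sum_le_tsum s
    _ = lpNorm a f := by simp [lpNorm]

/-- Equality in Hölder occurs at the tilted law proportional to `f ^ a`. -/
theorem exists_lpNorm_le_tsum {U : Type*} [Nonempty U] {a : ℝ} (ha : 1 < a) (f : U → ℝ≥0∞)
    (hf : ∑' u, f u ^ a ≠ ⊤) :
    ∃ K : PMF U, lpNorm a f ≤ ∑' u, f u * K u ^ ((a - 1) / a) := by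
  have h0 : 0 < a := by linarith
  by_cases hz : ∑' u, f u ^ a = 0
  · refine ⟨PMF.pure (Classical.arbitrary U), ?_⟩
    simp [lpNorm, hz, h0]
  refine ⟨PMF.normalize (fun u => f u ^ a) hz hf, le_of_eq ?_⟩
  set B := ∑' u, f u ^ a with hB
  have key : ∀ u, f u * (PMF.normalize (fun u => f u ^ a) hz hf) u ^ ((a - 1) / a)
      = f u ^ a * (B⁻¹) ^ ((a - 1) / a) := by
    intro u
    rw [PMF.normalize_apply, ENNReal.mul_rpow_of_nonneg _ _ (by apply div_nonneg <;> linarith),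
      ← ENNReal.rpow_mul, ← mul_assoc, show a * ((a - 1) / a) = a - 1 by field_simp]
    congr 1
    conv_lhs => rw [← ENNReal.rpow_one (f u)]
    rw [← ENNReal.rpow_mul, ← ENNReal.rpow_add_of_nonneg _ _ (by norm_num) (by linarith)]
    congr 1; ring
  simp_rw [key]
  rw [ENNReal.tsum_mul_right, ← hB, lpNorm, ← hB, ENNReal.inv_rpow, ← ENNReal.rpow_neg]
  conv_rhs => rw [← ENNReal.rpow_one B]
  rw [← ENNReal.rpow_mul, ← ENNReal.rpow_add _ _ hz hf]
  congr 1; field_simp; ring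

theorem tsum_rpow_le_tsum {U : Type*} {a : ℝ} (ha : 1 ≤ a) (f : U → ℝ≥0∞) (hf : ∀ u, f u ≤ 1) :
    ∑' u, f u ^ a ≤ ∑' u, f u :=
  ENNReal.tsum_le_tsum fun u => by
    conv_rhs => rw [← ENNReal.rpow_one (f u)]
    exact ENNReal.rpow_le_rpow_of_exponent_ge (hf u) ha

theorem PMF_tsum_slice_le {U S : Type*} (Q : PMF (U × S)) (s : S) : ∑' u, Q (u, s) ≤ 1 := by
  rw [← Q.tsum_coe]
  exact ENNReal.tsum_comp_le_tsum_of_injective (Prod.mk_left_injective s) Q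

/-- The kernel may be chosen separately for each observation, so the supremum of the sum is the sum
of the slice suprema. -/
theorem condMaxGain_eq {U S : Type*} (Q : PMF (U × S)) {a : ℝ} (ha : 1 < a) :
    condMaxGain Q ((a - 1) / a) = ∑' s, lpNorm a fun u => Q (u, s) := by
  have hprod : ∀ K : S → PMF U, ∑' p : U × S, Q p * K p.2 p.1 ^ ((a - 1) / a)
      = ∑' s, ∑' u, Q (u, s) * K s u ^ ((a - 1) / a) := fun K => by
    rw [ENNReal.tsum_prod (f := fun u s => Q (u, s) * K s u ^ ((a - 1) / a)), ENNReal.tsum_comm]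
  apply le_antisymm
  · refine iSup_le fun K => ?_
    rw [hprod]
    exact ENNReal.tsum_le_tsum fun s => tsum_mul_rpow_le_lpNorm ha _ _ (K s).tsum_coe.le
  · have : Nonempty U := ⟨Q.support_nonempty.some.1⟩
    have hK : ∀ s, ∃ K : PMF U, lpNorm a (fun u => Q (u, s))
        ≤ ∑' u, Q (u, s) * K u ^ ((a - 1) / a) := fun s =>
      exists_lpNorm_le_tsum ha _ (ne_top_of_le_ne_top ENNReal.one_ne_top
        ((tsum_rpow_le_tsum ha.le _ fun u => Q.coe_le_one _).trans (PMF_tsum_slice_le Q s)))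
    choose K hK using hK
    refine le_trans (ENNReal.tsum_le_tsum hK) ?_
    rw [← hprod]
    exact le_iSup (fun K : S → PMF U => ∑' p : U × S, Q p * K p.2 p.1 ^ ((a - 1) / a)) K

theorem maxGain_eq {U : Type*} (Q : PMF U) {a : ℝ} (ha : 1 < a) :
    maxGain Q ((a - 1) / a) = lpNorm a Q := by
  apply le_antisymm
  · exact iSup_le fun K => tsum_mul_rpow_le_lpNorm ha _ _ K.tsum_coe.le
  · have : Nonempty U := ⟨Q.support_nonempty.some⟩
    obtain ⟨K, hK⟩ := exists_lpNorm_le_tsum ha Q (ne_top_of_le_ne_top ENNReal.one_ne_top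
        ((tsum_rpow_le_tsum ha.le _ fun u => Q.coe_le_one _).trans Q.tsum_coe.le))
    exact hK.trans (le_iSup (fun K : PMF U => ∑' u, Q u * K u ^ ((a - 1) / a)) K)

/-! ### Monotonicity of the gains and the limit of infinite order. -/

theorem condMaxGain_antitone {U S : Type*} (Q : PMF (U × S)) : Antitone (condMaxGain Q) := by
  intro b c hbc
  refine iSup_mono fun K => ENNReal.tsum_le_tsum fun p => ?_
  exact mul_le_mul' le_rfl (ENNReal.rpow_le_rpow_of_exponent_ge ((K _).coe_le_one _) hbc)

theorem maxGain_antitone {U : Type*} (Q : PMF U) : Antitone (maxGain Q) := by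
  intro b c hbc
  refine iSup_mono fun K => ENNReal.tsum_le_tsum fun p => ?_
  exact mul_le_mul' le_rfl (ENNReal.rpow_le_rpow_of_exponent_ge (K.coe_le_one _) hbc)

theorem condMaxGain_le_one {U S : Type*} (Q : PMF (U × S)) {b : ℝ} (hb : 0 ≤ b) :
    condMaxGain Q b ≤ 1 := by
  refine iSup_le fun K => le_trans (ENNReal.tsum_le_tsum fun p => ?_) Q.tsum_coe.le
  exact mul_le_of_le_one_right' (ENNReal.rpow_le_one ((K _).coe_le_one _) hb)

theorem maxGain_le_one {U : Type*} (Q : PMF U) {b : ℝ} (hb : 0 ≤ b) : maxGain Q b ≤ 1 := by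
  refine iSup_le fun K => le_trans (ENNReal.tsum_le_tsum fun p => ?_) Q.tsum_coe.le
  exact mul_le_of_le_one_right' (ENNReal.rpow_le_one (K.coe_le_one _) hb)

theorem condMaxGain_pos {U S : Type*} (Q : PMF (U × S)) (b : ℝ) : 0 < condMaxGain Q b := by
  obtain ⟨p, hp⟩ := Q.support_nonempty
  have hp' : Q p ≠ 0 := (Q.mem_support_iff p).1 hp
  refine lt_of_lt_of_le ?_ (le_iSup (fun K : S → PMF U => ∑' p : U × S, Q p * K p.2 p.1 ^ b)
    fun _ => PMF.pure p.1)
  refine lt_of_lt_of_le ?_ (ENNReal.le_tsum p)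
  simpa [pos_iff_ne_zero] using hp'

theorem maxGain_pos {U : Type*} (Q : PMF U) (b : ℝ) : 0 < maxGain Q b := by
  obtain ⟨p, hp⟩ := Q.support_nonempty
  have hp' : Q p ≠ 0 := (Q.mem_support_iff p).1 hp
  refine lt_of_lt_of_le ?_ (le_iSup (fun K : PMF U => ∑' p : U, Q p * K p ^ b) (PMF.pure p))
  refine lt_of_lt_of_le ?_ (ENNReal.le_tsum p)
  simpa [pos_iff_ne_zero] using hp'

theorem tendsto_sub_one_div_atTop :
    Tendsto (fun a : ℝ => (a - 1) / a) atTop (𝓝[<] 1) := by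
  have h : Tendsto (fun a : ℝ => 1 - a⁻¹) atTop (𝓝 1) := by
    simpa using tendsto_inv_atTop_zero.const_sub (1 : ℝ)
  refine tendsto_nhdsWithin_iff.2 ⟨h.congr' ?_, ?_⟩
  · filter_upwards [eventually_gt_atTop 0] with a ha
    field_simp
  · filter_upwards [eventually_gt_atTop 0] with a ha
    simp only [Set.mem_Iio]
    rw [div_lt_one ha]; linarith

theorem tendsto_div_sub_one_atTop :
    Tendsto (fun a : ℝ => ((a / (a - 1) : ℝ) : EReal)) atTop (𝓝 1) := by
  have h : Tendsto (fun a : ℝ => ((a - 1) / a)⁻¹) atTop (𝓝 1) := by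
    simpa using (tendsto_sub_one_div_atTop.mono_right nhdsWithin_le_nhds).inv₀ one_ne_zero
  simp_rw [inv_div] at h
  exact (continuous_coe_real_ereal.tendsto _).comp h

/-- The limit at infinity of `a / (a - 1) * log (f (1 - 1 / a) / g (1 - 1 / a))`
exists for antitone gains `f`, `g` that are positive and at most one. -/
theorem exists_tendsto_mul_log_div {f g : ℝ → ℝ≥0∞} (hf : Antitone f) (hg : Antitone g)
    (hf0 : 0 < f 1) (hg0 : 0 < g 1) (hf1 : f 0 ≤ 1) (hg1 : g 0 ≤ 1) :
    ∃ L : EReal, Tendsto (fun a : ℝ => ((a / (a - 1) : ℝ) : EReal) *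
      ENNReal.log (f ((a - 1) / a) / g ((a - 1) / a))) atTop (𝓝 L) := by
  have aux : ∀ h : ℝ → ℝ≥0∞, Antitone h → 0 < h 1 → h 0 ≤ 1 → ∃ l, l ≠ 0 ∧ l ≠ ⊤ ∧
      Tendsto (fun a : ℝ => h ((a - 1) / a)) atTop (𝓝 l) := by
    intro h hh h0 h1
    -- An antitone function has a left limit at 1, the infimum of its values on the left. It lies
    -- between `h 1 > 0` and `h 0 ≤ 1`, so the quotient of two such limits is harmless.
    refine ⟨_, ?_, ?_, (hh.tendsto_nhdsLT 1).comp tendsto_sub_one_div_atTop⟩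
    · refine (lt_of_lt_of_le h0 ?_).ne'
      refine le_sInf ?_
      rintro _ ⟨x, hx, rfl⟩
      exact hh (le_of_lt hx)
    · refine ne_top_of_le_ne_top ENNReal.one_ne_top (le_trans (sInf_le ⟨0, ?_, rfl⟩) h1)
      simp
  obtain ⟨l, hl0, hlt, hl⟩ := aux f hf hf0 hf1
  obtain ⟨m, hm0, hmt, hm⟩ := aux g hg hg0 hg1
  refine ⟨_, EReal.Tendsto.mul tendsto_div_sub_one_atTop
    ((ENNReal.continuous_log.tendsto _).comp (ENNReal.Tendsto.div hl (.inl hl0) hm (.inl hmt)))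
    ?_ ?_ ?_ ?_⟩ <;> left
  · exact one_ne_zero
  · exact one_ne_zero
  · exact EReal.coe_ne_bot 1
  · exact EReal.coe_ne_top 1

theorem exists_tendsto_leakageReal_atTop {U Y : Type*} (Q : PMF (U × Y)) :
    ∃ L, Tendsto (leakageReal Q) atTop (𝓝 L) :=
  exists_tendsto_mul_log_div (condMaxGain_antitone Q) (maxGain_antitone _) (condMaxGain_pos _ _)
    (maxGain_pos _ _) (condMaxGain_le_one _ le_rfl) (maxGain_le_one _ le_rfl)

theorem exists_tendsto_condLeakageReal_atTop {U Y Z : Type*} (Q : PMF (U × Y × Z)) :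
    ∃ L, Tendsto (condLeakageReal Q) atTop (𝓝 L) :=
  exists_tendsto_mul_log_div (condMaxGain_antitone Q) (condMaxGain_antitone _)
    (condMaxGain_pos _ _) (condMaxGain_pos _ _) (condMaxGain_le_one _ le_rfl)
    (condMaxGain_le_one _ le_rfl)

/-! ### First-order behaviour of powers as the order decreases to one. -/

/-- `b (e^{s log b} - 1) / (a - 1) → k b log b` when `s / (a - 1) → k` as `a → 1+`. -/
theorem tendsto_rpow_sub_self_div {B s : ℝ → ℝ} {b k : ℝ} (hb : 0 < b)
    (hB : Tendsto B (𝓝[>] 1) (𝓝 b))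
    (hs : Tendsto (fun a => s a / (a - 1)) (𝓝[>] 1) (𝓝 k)) :
    Tendsto (fun a => (B a ^ (1 + s a) - B a) / (a - 1)) (𝓝[>] 1) (𝓝 (k * (b * Real.log b))) := by
  have hlog : Tendsto (fun a => Real.log (B a)) (𝓝[>] 1) (𝓝 (Real.log b)) := hB.log hb.ne'
  have hsub : Tendsto (fun a : ℝ => a - 1) (𝓝[>] 1) (𝓝 0) := by
    have : Tendsto (fun a : ℝ => a - 1) (𝓝 1) (𝓝 (1 - 1)) := tendsto_id.sub_const 1
    rw [sub_self] at this
    exact this.mono_left nhdsWithin_le_nhds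
  have hpos : ∀ᶠ a : ℝ in 𝓝[>] 1, 0 < a - 1 := by
    filter_upwards [self_mem_nhdsWithin] with a ha using sub_pos.2 ha
  have hBpos : ∀ᶠ a in 𝓝[>] 1, 0 < B a := hB.eventually (lt_mem_nhds hb)
  have hs0 : Tendsto s (𝓝[>] 1) (𝓝 0) := by
    have := hs.mul hsub
    rw [mul_zero] at this
    refine this.congr' ?_
    filter_upwards [hpos] with a ha using div_mul_cancel₀ _ ha.ne'
  have hx : Tendsto (fun a => s a / (a - 1) * (B a * Real.log (B a))) (𝓝[>] 1)
      (𝓝 (k * (b * Real.log b))) := hs.mul (hB.mul hlog)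
  have hx' : Tendsto (fun a => s a / (a - 1) * (B a * Real.log (B a)) *
      Real.exp (s a * Real.log (B a))) (𝓝[>] 1) (𝓝 (k * (b * Real.log b))) := by
    have h := hx.mul ((Real.continuous_exp.tendsto _).comp (hs0.mul hlog))
    simpa using h
  have hrew : ∀ᶠ a in 𝓝[>] 1, (B a ^ (1 + s a) - B a) / (a - 1)
      = B a * (Real.exp (s a * Real.log (B a)) - 1) / (a - 1) := by
    filter_upwards [hBpos] with a ha
    rw [Real.rpow_add ha, Real.rpow_one, Real.rpow_def_of_pos ha (s a), mul_comm (Real.log _)]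
    ring
  -- Squeeze by x ≤ e^x - 1 ≤ x e^x, valid for either sign of x = s log B.
  refine tendsto_of_tendsto_of_tendsto_of_le_of_le' hx hx' ?_ ?_
  · filter_upwards [hrew, hpos, hBpos] with a ha hp hBa
    rw [ha, div_mul_eq_mul_div, div_le_div_iff_of_pos_right hp]
    have := Real.add_one_le_exp (s a * Real.log (B a))
    nlinarith
  · filter_upwards [hrew, hpos, hBpos] with a ha hp hBa
    rw [ha, div_mul_eq_mul_div, div_mul_eq_mul_div, div_le_div_iff_of_pos_right hp]
    set x := s a * Real.log (B a) with hxdef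
    have h1 := Real.add_one_le_exp (-x)
    have h2 : Real.exp x * Real.exp (-x) = 1 := by rw [← Real.exp_add]; simp
    have h3 : Real.exp x - 1 ≤ x * Real.exp x := by nlinarith [Real.exp_pos x]
    calc B a * (Real.exp x - 1) ≤ B a * (x * Real.exp x) := by gcongr
      _ = _ := by rw [hxdef]; ring

theorem tendsto_one_div_sub_one_div :
    Tendsto (fun a : ℝ => (1 / a - 1) / (a - 1)) (𝓝[>] 1) (𝓝 (-1)) := by
  have h : Tendsto (fun a : ℝ => -a⁻¹) (𝓝[>] 1) (𝓝 (-1)) := by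
    have : Tendsto (fun a : ℝ => -a⁻¹) (𝓝 1) (𝓝 (-1⁻¹)) := (tendsto_inv₀ one_ne_zero).neg
    rw [inv_one] at this
    exact this.mono_left nhdsWithin_le_nhds
  refine h.congr' ?_
  filter_upwards [self_mem_nhdsWithin] with a ha
  have h1 : a - 1 ≠ 0 := (sub_pos.2 ha).ne'
  have h2 : a ≠ 0 := by rintro rfl; simp at ha; linarith
  field_simp; ring

theorem tendsto_sub_one_div_self :
    Tendsto (fun a : ℝ => (a - 1) / (a - 1)) (𝓝[>] 1) (𝓝 1) := by
  refine tendsto_const_nhds.congr' ?_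
  filter_upwards [self_mem_nhdsWithin] with a ha
  rw [div_self (sub_pos.2 ha).ne']

theorem tendsto_rpow_inv_sub_self_div {B : ℝ → ℝ} {b : ℝ} (hb : 0 < b)
    (hB : Tendsto B (𝓝[>] 1) (𝓝 b)) :
    Tendsto (fun a => (B a ^ (1 / a) - B a) / (a - 1)) (𝓝[>] 1) (𝓝 (Real.negMulLog b)) := by
  have := tendsto_rpow_sub_self_div hb hB tendsto_one_div_sub_one_div
  simpa [Real.negMulLog] using this

theorem tendsto_const_rpow_sub_div {t : ℝ} (ht : 0 ≤ t) :
    Tendsto (fun a => (t ^ a - t) / (a - 1)) (𝓝[>] 1) (𝓝 (-Real.negMulLog t)) := by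
  rcases ht.eq_or_lt with rfl | ht
  · simp only [Real.negMulLog_zero, neg_zero]
    refine tendsto_const_nhds.congr' ?_
    filter_upwards [self_mem_nhdsWithin] with a ha
    rw [Real.zero_rpow (by rintro rfl; simp at ha; linarith)]; simp
  · have := tendsto_rpow_sub_self_div ht tendsto_const_nhds tendsto_sub_one_div_self
    simpa [Real.negMulLog] using this

theorem summable_rpow {U : Type*} {t : U → ℝ} (h0 : ∀ u, 0 ≤ t u) (h1 : ∀ u, t u ≤ 1)
    (ht : Summable t) {a : ℝ} (ha : 1 ≤ a) : Summable fun u => t u ^ a :=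
  ht.of_nonneg_of_le (fun u => Real.rpow_nonneg (h0 u) a)
    fun u => Real.rpow_le_self_of_le_one (h0 u) (h1 u) ha

theorem continuousOn_tsum_rpow {U : Type*} {t : U → ℝ} (h0 : ∀ u, 0 ≤ t u) (h1 : ∀ u, t u ≤ 1)
    (ht : Summable t) : ContinuousOn (fun a : ℝ => ∑' u, t u ^ a) (Set.Ici 1) := by
  refine continuousOn_tsum (fun u => ?_) ht fun u a ha => ?_
  · intro a ha
    have : a ≠ 0 := by rintro rfl; simp at ha; linarith
    exact (Real.continuousAt_const_rpow' this).continuousWithinAt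
  · rw [Real.norm_of_nonneg (Real.rpow_nonneg (h0 u) a)]
    exact Real.rpow_le_self_of_le_one (h0 u) (h1 u) ha

theorem tendsto_tsum_rpow {U : Type*} {t : U → ℝ} (h0 : ∀ u, 0 ≤ t u) (h1 : ∀ u, t u ≤ 1)
    (ht : Summable t) : Tendsto (fun a : ℝ => ∑' u, t u ^ a) (𝓝[>] 1) (𝓝 (∑' u, t u)) := by
  have := (continuousOn_tsum_rpow h0 h1 ht 1 Set.self_mem_Ici).mono_left
    (nhdsWithin_mono 1 Set.Ioi_subset_Ici_self)
  simpa using this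

/-- Each term is `w y * w y ^ (a - 1)`, and the second factor grows when `w y` is replaced by the
total. -/
theorem sum_rpow_le_rpow_sum {Y : Type*} [Fintype Y] {w : Y → ℝ} (h0 : ∀ y, 0 ≤ w y) {a : ℝ}
    (ha : 1 ≤ a) : ∑ y, w y ^ a ≤ (∑ y, w y) ^ a := by
  have key : ∀ {t : ℝ}, 0 ≤ t → t ^ a = t * t ^ (a - 1) := fun {t} ht => by
    conv_lhs => rw [show a = 1 + (a - 1) by ring]
    rw [Real.rpow_add_of_nonneg ht zero_le_one (by linarith), Real.rpow_one]
  rw [key (Finset.sum_nonneg fun y _ => h0 y), Finset.sum_mul]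
  refine Finset.sum_le_sum fun y _ => ?_
  rw [key (h0 y)]
  exact mul_le_mul_of_nonneg_left (Real.rpow_le_rpow (h0 y)
    (Finset.single_le_sum (fun y _ => h0 y) (Finset.mem_univ y)) (by linarith)) (h0 y)

theorem rpow_sum_le_sum_rpow {Y : Type*} [Fintype Y] {w : Y → ℝ} (h0 : ∀ y, 0 ≤ w y) {a : ℝ}
    (ha : 1 ≤ a) : (∑ y, w y) ^ (1 / a) ≤ ∑ y, w y ^ (1 / a) := by
  have h := sum_rpow_le_rpow_sum (fun y => Real.rpow_nonneg (h0 y) (1 / a)) ha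
  have ha0 : a ≠ 0 := by linarith
  have : ∀ y, (w y ^ (1 / a)) ^ a = w y := fun y => by
    rw [← Real.rpow_mul (h0 y), one_div_mul_cancel ha0, Real.rpow_one]
  simp_rw [this] at h
  calc (∑ y, w y) ^ (1 / a) ≤ ((∑ y, w y ^ (1 / a)) ^ a) ^ (1 / a) :=
        Real.rpow_le_rpow (Finset.sum_nonneg fun y _ => h0 y) h (by positivity)
    _ = _ := by
        rw [← Real.rpow_mul (Finset.sum_nonneg fun y _ => Real.rpow_nonneg (h0 y) _),
          mul_one_div_cancel ha0, Real.rpow_one]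

theorem rpow_sum_le_card_mul {Y : Type*} [Fintype Y] {w : Y → ℝ} (h0 : ∀ y, 0 ≤ w y) {a : ℝ}
    (ha : 1 ≤ a) : (∑ y, w y) ^ a ≤ (Fintype.card Y : ℝ) ^ (a - 1) * ∑ y, w y ^ a :=
  Real.rpow_sum_le_const_mul_sum_rpow_of_nonneg Finset.univ ha fun y _ => h0 y

/-! ### Mass-weighted entropy. -/

/-- The entropy of `w / ∑ w`, weighted by the total mass `∑ w`. -/
noncomputable def massEntropy {Y : Type*} [Fintype Y] (w : Y → ℝ) : ℝ :=
  ∑ y, Real.negMulLog (w y) - Real.negMulLog (∑ y, w y)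

/-- Gibbs' inequality. -/
theorem massEntropy_le {Y : Type*} [Fintype Y] {w b : Y → ℝ} (hw : ∀ y, 0 ≤ w y)
    (hb : ∀ y, 0 ≤ b y) (hwb : ∀ y, b y = 0 → w y = 0) :
    massEntropy w ≤ ∑ y, w y * (Real.log (∑ y, b y) - Real.log (b y)) := by
  set t := ∑ y, w y with ht
  set s := ∑ y, b y with hs
  have ht0 : 0 ≤ t := Finset.sum_nonneg fun y _ => hw y
  have hs0 : 0 ≤ s := Finset.sum_nonneg fun y _ => hb y
  rcases ht0.eq_or_lt with htz | htpos
  · have hz : ∀ y, w y = 0 := fun y =>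
      (Finset.sum_eq_zero_iff_of_nonneg fun y _ => hw y).1 (ht ▸ htz.symm) y (Finset.mem_univ y)
    simp [massEntropy, hz]
  have hspos : 0 < s := by
    rcases hs0.eq_or_lt with h | h
    · have hz : ∀ y, b y = 0 := fun y =>
        (Finset.sum_eq_zero_iff_of_nonneg fun y _ => hb y).1 (hs ▸ h.symm) y (Finset.mem_univ y)
      have : t = 0 := Finset.sum_eq_zero fun y _ => hwb y (hz y)
      linarith
    · exact h
  -- This is log r ≤ r - 1 at r = b t / (s w), multiplied by w; the corrections b t / s - w sum to
  -- zero.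
  have hterm : ∀ y, Real.negMulLog (w y) + w y * Real.log t
      ≤ w y * (Real.log s - Real.log (b y)) + (b y * t / s - w y) := by
    intro y
    rcases (hw y).eq_or_lt with h | h
    · rw [← h]
      have : 0 ≤ b y * t / s := div_nonneg (mul_nonneg (hb y) ht0) hs0
      simpa using this
    · have hby : 0 < b y := (hb y).lt_of_ne fun h' => h.ne' (hwb y h'.symm)
      have h1 := Real.log_le_sub_one_of_pos (show 0 < b y * t / (s * w y) by positivity)
      rw [Real.log_div (by positivity) (by positivity), Real.log_mul hby.ne' htpos.ne',
        Real.log_mul hspos.ne' h.ne'] at h1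
      have h2 := mul_le_mul_of_nonneg_left h1 h.le
      have h3 : w y * (b y * t / (s * w y) - 1) = b y * t / s - w y := by field_simp
      rw [h3] at h2
      simp only [Real.negMulLog]
      linarith
  have hsum := Finset.sum_le_sum fun y (_ : y ∈ Finset.univ) => hterm y
  rw [Finset.sum_add_distrib, Finset.sum_add_distrib, ← Finset.sum_mul, Finset.sum_sub_distrib,
    ← Finset.sum_div, ← Finset.sum_mul, ← ht, ← hs, mul_div_cancel_left₀ _ hspos.ne'] at hsum
  simp only [massEntropy, ← ht]
  have : Real.negMulLog t = -(t * Real.log t) := by simp [Real.negMulLog]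
  linarith

theorem massEntropy_eq {Y : Type*} [Fintype Y] (w : Y → ℝ) :
    massEntropy w = ∑ y, w y * (Real.log (∑ y, w y) - Real.log (w y)) := by
  simp only [massEntropy, Real.negMulLog, mul_sub, Finset.sum_sub_distrib, ← Finset.sum_mul,
    neg_mul, Finset.sum_neg_distrib]
  ring

theorem massEntropy_nonneg {Y : Type*} [Fintype Y] {w : Y → ℝ} (hw : ∀ y, 0 ≤ w y) :
    0 ≤ massEntropy w := by
  rw [massEntropy_eq]
  refine Finset.sum_nonneg fun y _ => ?_
  rcases (hw y).eq_or_lt with h | h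
  · simp [← h]
  · exact mul_nonneg h.le (sub_nonneg.2 (Real.log_le_log h
      (Finset.single_le_sum (fun y _ => hw y) (Finset.mem_univ y))))

theorem massEntropy_smul {Y : Type*} [Fintype Y] {c : ℝ} (w : Y → ℝ) :
    massEntropy (fun y => c * w y) = c * massEntropy w := by
  simp only [massEntropy, ← Finset.mul_sum, Real.negMulLog_mul, Finset.sum_add_distrib,
    ← Finset.sum_mul]
  ring

/-- Superadditivity of the mass-weighted entropy. -/
theorem summable_and_tsum_massEntropy_le {Y ι : Type*} [Fintype Y] {w : ι → Y → ℝ} {b : Y → ℝ}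
    (hw : ∀ i y, 0 ≤ w i y) (hb : ∀ y, HasSum (fun i => w i y) (b y)) :
    Summable (fun i => massEntropy (w i)) ∧ ∑' i, massEntropy (w i) ≤ massEntropy b := by
  have hb0 : ∀ y, 0 ≤ b y := fun y => (hb y).nonneg fun i => hw i y
  -- The cross entropy against the total `b` is linear in `w i`, so these bounds sum exactly to the
  -- entropy of `b`.
  have hle : ∀ i, massEntropy (w i) ≤ ∑ y, w i y * (Real.log (∑ y, b y) - Real.log (b y)) :=
    fun i => massEntropy_le (hw i) hb0 fun y hy => by
      have h := (hasSum_zero_iff_of_nonneg fun i => hw i y).1 (hy ▸ hb y)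
      exact congrFun h i
  have hs : HasSum (fun i => ∑ y, w i y * (Real.log (∑ y, b y) - Real.log (b y)))
      (massEntropy b) := by
    rw [massEntropy_eq]
    exact hasSum_sum fun y _ => (hb y).mul_right _
  have hsum : Summable (fun i => massEntropy (w i)) :=
    hs.summable.of_nonneg_of_le (fun i => massEntropy_nonneg (hw i)) hle
  exact ⟨hsum, (hsum.tsum_le_tsum hle hs.summable).trans hs.tsum_eq.le⟩

/-! ### Expansion of the gains near order one. -/

theorem tendsto_inv_rpow_tsum_sub_div {U : Type*} {t : U → ℝ} (h0 : ∀ u, 0 ≤ t u)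
    (h1 : ∀ u, t u ≤ 1) (ht : Summable t) :
    Tendsto (fun a : ℝ => ((∑' u, t u ^ a) ^ (1 / a) - ∑' u, t u ^ a) / (a - 1)) (𝓝[>] 1)
      (𝓝 (Real.negMulLog (∑' u, t u))) := by
  rcases (tsum_nonneg h0).eq_or_lt with h | h
  · have hz : t = 0 := (hasSum_zero_iff_of_nonneg h0).1 (h ▸ ht.hasSum)
    subst hz
    simp only [Pi.zero_apply, tsum_zero, Real.negMulLog_zero]
    refine tendsto_const_nhds.congr' ?_
    filter_upwards [self_mem_nhdsWithin] with a ha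
    have : a ≠ 0 := by rintro rfl; simp at ha; linarith
    simp [Real.zero_rpow this, Real.zero_rpow (inv_ne_zero this)]
  · exact tendsto_rpow_inv_sub_self_div h (tendsto_tsum_rpow h0 h1 ht)

theorem card_rpow_le {K s : ℝ} (hK : 0 ≤ K) (hs0 : 0 ≤ s) (hs1 : s ≤ 1) :
    K ^ s ≤ 1 + s * K := by
  have := rpow_one_add_le_one_add_mul_self (s := K - 1) (by linarith) hs0 hs1
  rw [add_sub_cancel] at this
  nlinarith

/-- Supplies a dominating bound linear in a - 1. The power mean inequality gives Σ w^a ≥ K^(1-a) (Σ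
w)^a with K = |Y|, and K^(1-a) ≥ 1 - (a - 1) log K. -/
theorem rpow_sum_sub_le {Y : Type*} [Fintype Y] [Nonempty Y] {w : Y → ℝ} (h0 : ∀ y, 0 ≤ w y)
    (h1 : ∑ y, w y ≤ 1) {a : ℝ} (ha : 1 < a) :
    (∑ y, w y) ^ a - ∑ y, w y ^ a ≤ (a - 1) * Real.log (Fintype.card Y) * ∑ y, w y := by
  set K : ℝ := (Fintype.card Y : ℝ)
  have hK : 0 < K := by simpa [K] using Fintype.card_pos
  have hK1 : 1 ≤ K := by
    have : 1 ≤ Fintype.card Y := Fintype.card_pos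
    simpa [K] using this
  have h := rpow_sum_le_card_mul h0 ha.le
  have hinv : K ^ (1 - a) * K ^ (a - 1) = 1 := by rw [← Real.rpow_add hK]; simp
  have h2 : K ^ (1 - a) * (∑ y, w y) ^ a ≤ ∑ y, w y ^ a := by
    calc _ ≤ K ^ (1 - a) * (K ^ (a - 1) * ∑ y, w y ^ a) := by gcongr
      _ = _ := by rw [← mul_assoc, hinv, one_mul]
  have h3 : 1 - (a - 1) * Real.log K ≤ K ^ (1 - a) := by
    rw [Real.rpow_def_of_pos hK]
    have := Real.add_one_le_exp (Real.log K * (1 - a))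
    linarith
  have hs := Finset.sum_nonneg fun y (_ : y ∈ Finset.univ) => h0 y
  have h4 := Real.rpow_le_self_of_le_one hs h1 ha.le
  have h5 : 0 ≤ (∑ y, w y) ^ a := Real.rpow_nonneg hs a
  have h6 : 0 ≤ Real.log K := Real.log_nonneg hK1
  have h7 : 0 ≤ (a - 1) * Real.log K := mul_nonneg (by linarith) h6
  nlinarith

section Slice

variable {U Y : Type*} [Fintype Y] {q : U → Y → ℝ}

theorem entry_le_one (h0 : ∀ u y, 0 ≤ q u y) (h1 : ∀ u, ∑ y, q u y ≤ 1) (u : U) (y : Y) :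
    q u y ≤ 1 :=
  (Finset.single_le_sum (fun y _ => h0 u y) (Finset.mem_univ y)).trans (h1 u)

theorem summable_entry (h0 : ∀ u y, 0 ≤ q u y) (hs : Summable fun u => ∑ y, q u y) (y : Y) :
    Summable fun u => q u y :=
  hs.of_nonneg_of_le (fun u => h0 u y)
    fun u => Finset.single_le_sum (fun y _ => h0 u y) (Finset.mem_univ y)

/-- The two sums must be differentiated together: on an infinite alphabet of U each separate entropy
may diverge, while the difference is dominated by log |Y| times the mass. -/
theorem tendsto_tsum_rpow_sub_sum_div [Nonempty Y] (h0 : ∀ u y, 0 ≤ q u y)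
    (h1 : ∀ u, ∑ y, q u y ≤ 1) (hs : Summable fun u => ∑ y, q u y) :
    Tendsto (fun a : ℝ => (∑' u, (∑ y, q u y) ^ a - ∑ y, ∑' u, q u y ^ a) / (a - 1)) (𝓝[>] 1)
      (𝓝 (∑' u, massEntropy (q u))) := by
  have hpt : ∀ u, Tendsto (fun a : ℝ => ((∑ y, q u y) ^ a - ∑ y, q u y ^ a) / (a - 1)) (𝓝[>] 1)
      (𝓝 (massEntropy (q u))) := by
    intro u
    have ht := tendsto_const_rpow_sub_div (Finset.sum_nonneg fun y (_ : y ∈ Finset.univ) => h0 u y)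
    have hy := tendsto_finsetSum Finset.univ fun y (_ : y ∈ Finset.univ) =>
      tendsto_const_rpow_sub_div (h0 u y)
    have := ht.sub hy
    rw [Finset.sum_neg_distrib, neg_sub_neg] at this
    refine this.congr fun a => ?_
    rw [← Finset.sum_div, ← sub_div, Finset.sum_sub_distrib]
    congr 1; ring
  have hdom := tendsto_tsum_of_dominated_convergence
    (hs.mul_left (Real.log (Fintype.card Y))) hpt ?_
  · refine hdom.congr' ?_
    filter_upwards [self_mem_nhdsWithin] with a ha
    have ha1 : (1 : ℝ) ≤ a := le_of_lt ha
    have hS := summable_rpow (fun u => Finset.sum_nonneg fun y _ => h0 u y) h1 hs ha1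
    have hE : ∀ y, Summable fun u => q u y ^ a := fun y =>
      summable_rpow (fun u => h0 u y) (fun u => entry_le_one h0 h1 u y) (summable_entry h0 hs y) ha1
    rw [tsum_div_const, hS.tsum_sub (summable_sum fun y _ => hE y), Summable.tsum_finsetSum
      fun y _ => hE y]
  · filter_upwards [self_mem_nhdsWithin] with a ha u
    have hp : 0 < a - 1 := sub_pos.2 ha
    rw [Real.norm_of_nonneg (div_nonneg (sub_nonneg.2
      (sum_rpow_le_rpow_sum (h0 u) (le_of_lt ha))) hp.le), div_le_iff₀ hp]
    have := rpow_sum_sub_le (h0 u) (h1 u) ha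
    linarith

/-- With A_y = Σ_u q^a and B = Σ_u (Σ_y q)^a, the numerator is Σ_y (A_y^(1/a) - A_y) - (B^(1/a) - B)
- (B - Σ_y A_y), and each of the three pieces has a known first-order limit. -/
theorem tendsto_slice_gain_sub_div [Nonempty Y] (h0 : ∀ u y, 0 ≤ q u y)
    (hs : Summable fun u => ∑ y, q u y) (hs1 : ∑' u, ∑ y, q u y ≤ 1) :
    Tendsto (fun a : ℝ => (∑ y, (∑' u, q u y ^ a) ^ (1 / a)
      - (∑' u, (∑ y, q u y) ^ a) ^ (1 / a)) / (a - 1)) (𝓝[>] 1)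
      (𝓝 (massEntropy (fun y => ∑' u, q u y) - ∑' u, massEntropy (q u))) := by
  have hn : ∀ u, 0 ≤ ∑ y, q u y := fun u => Finset.sum_nonneg fun y _ => h0 u y
  have h1 : ∀ u, ∑ y, q u y ≤ 1 := fun u => (hs.le_tsum u fun u _ => hn u).trans hs1
  have hA := tendsto_finsetSum Finset.univ fun y (_ : y ∈ Finset.univ) =>
    tendsto_inv_rpow_tsum_sub_div (fun u => h0 u y) (fun u => entry_le_one h0 h1 u y)
      (summable_entry h0 hs y)
  have hB := tendsto_inv_rpow_tsum_sub_div hn h1 hs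
  have hC := tendsto_tsum_rpow_sub_sum_div h0 h1 hs
  have := (hA.sub hB).sub hC
  rw [Summable.tsum_finsetSum fun y _ => summable_entry h0 hs y] at this
  refine this.congr fun a => ?_
  rw [← Finset.sum_div, ← sub_div, ← sub_div, Finset.sum_sub_distrib]
  congr 1; ring

/-- Makes the expansion uniform in z. The gains N and D with and without y differ by at most the
factor κ = |Y|^((a-1)/a) either way, κ - 1 ≤ (a - 1) |Y|, and D is at most the mass of the slice. -/
theorem abs_slice_gain_sub_le [Nonempty Y] (h0 : ∀ u y, 0 ≤ q u y)
    (hs : Summable fun u => ∑ y, q u y) (hs1 : ∑' u, ∑ y, q u y ≤ 1) {a : ℝ} (ha : 1 < a) :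
    (∑' u, (∑ y, q u y) ^ a) ^ (1 / a) ≤ ∑' u, ∑ y, q u y ∧
    |∑ y, (∑' u, q u y ^ a) ^ (1 / a) - (∑' u, (∑ y, q u y) ^ a) ^ (1 / a)|
      ≤ (a - 1) * (Fintype.card Y * ∑' u, ∑ y, q u y) := by
  have hn : ∀ u, 0 ≤ ∑ y, q u y := fun u => Finset.sum_nonneg fun y _ => h0 u y
  have h1 : ∀ u, ∑ y, q u y ≤ 1 := fun u => (hs.le_tsum u fun u _ => hn u).trans hs1
  have ha0 : 0 < a := by linarith
  set K : ℝ := (Fintype.card Y : ℝ) with hKdef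
  have hK : 0 < K := by simpa [K] using Fintype.card_pos
  set p := ∑' u, ∑ y, q u y with hp
  have hp0 : 0 ≤ p := tsum_nonneg hn
  have hS := summable_rpow hn h1 hs ha.le
  have hE : ∀ y, Summable fun u => q u y ^ a := fun y =>
    summable_rpow (fun u => h0 u y) (fun u => entry_le_one h0 h1 u y) (summable_entry h0 hs y) ha.le
  set A : Y → ℝ := fun y => ∑' u, q u y ^ a with hAdef
  set B := ∑' u, (∑ y, q u y) ^ a with hBdef
  have hA0 : ∀ y, 0 ≤ A y := fun y => tsum_nonneg fun u => Real.rpow_nonneg (h0 u y) a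
  have hB0 : 0 ≤ B := tsum_nonneg fun u => Real.rpow_nonneg (hn u) a
  have hAB : ∑ y, A y ≤ B := by
    rw [hAdef, ← Summable.tsum_finsetSum fun y _ => hE y]
    exact (summable_sum fun y _ => hE y).tsum_le_tsum
      (fun u => sum_rpow_le_rpow_sum (h0 u) ha.le) hS
  have hBA : B ≤ K ^ (a - 1) * ∑ y, A y := by
    rw [hAdef, ← Summable.tsum_finsetSum fun y _ => hE y, ← tsum_mul_left]
    exact hS.tsum_le_tsum (fun u => rpow_sum_le_card_mul (h0 u) ha.le)
      ((summable_sum fun y _ => hE y).mul_left _)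
  have hBp : B ^ (1 / a) ≤ p := by
    have hle : B ≤ p ^ a := by
      have key : ∀ {t : ℝ}, 0 ≤ t → t ^ a = t * t ^ (a - 1) := fun {t} ht => by
        conv_lhs => rw [show a = 1 + (a - 1) by ring]
        rw [Real.rpow_add_of_nonneg ht zero_le_one (by linarith), Real.rpow_one]
      rw [key hp0, hp, ← tsum_mul_right, ← hp]
      refine hS.tsum_le_tsum (fun u => ?_) (hs.mul_right _)
      rw [key (hn u)]
      exact mul_le_mul_of_nonneg_left (Real.rpow_le_rpow (hn u)
        (hs.le_tsum u fun u _ => hn u) (by linarith)) (hn u)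
    calc B ^ (1 / a) ≤ (p ^ a) ^ (1 / a) := Real.rpow_le_rpow hB0 hle (by positivity)
      _ = p := by rw [← Real.rpow_mul hp0, mul_one_div_cancel ha0.ne', Real.rpow_one]
  refine ⟨hBp, ?_⟩
  set N := ∑ y, A y ^ (1 / a) with hN
  have hN0 : 0 ≤ N := Finset.sum_nonneg fun y _ => Real.rpow_nonneg (hA0 y) _
  set D := B ^ (1 / a) with hD
  have hD0 : 0 ≤ D := Real.rpow_nonneg hB0 _
  set κ := K ^ ((a - 1) / a) with hκ
  have hκ0 : 0 < κ := Real.rpow_pos_of_pos hK _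
  have hKκ : (K ^ (a - 1)) ^ (1 / a) = κ := by
    rw [← Real.rpow_mul hK.le, hκ]; congr 1; ring
  have hND : N ≤ κ * D := by
    have h := rpow_sum_le_card_mul (fun y => Real.rpow_nonneg (hA0 y) (1 / a)) ha.le
    have hy : ∀ y, (A y ^ (1 / a)) ^ a = A y := fun y => by
      rw [← Real.rpow_mul (hA0 y), one_div_mul_cancel ha0.ne', Real.rpow_one]
    simp_rw [hy] at h
    calc N = (N ^ a) ^ (1 / a) := by
          rw [← Real.rpow_mul hN0, mul_one_div_cancel ha0.ne', Real.rpow_one]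
      _ ≤ (K ^ (a - 1) * B) ^ (1 / a) := by
          refine Real.rpow_le_rpow (Real.rpow_nonneg hN0 _) (h.trans ?_) (by positivity)
          gcongr
      _ = κ * D := by rw [Real.mul_rpow (by positivity) hB0, hKκ]
  have hDN : D ≤ κ * N := by
    calc D ≤ (K ^ (a - 1) * ∑ y, A y) ^ (1 / a) := Real.rpow_le_rpow hB0 hBA (by positivity)
      _ = κ * (∑ y, A y) ^ (1 / a) := by
          rw [Real.mul_rpow (by positivity) (Finset.sum_nonneg fun y _ => hA0 y), hKκ]
      _ ≤ κ * N := by gcongr; exact rpow_sum_le_sum_rpow hA0 ha.le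
  have hκ1 : κ ≤ 1 + (a - 1) * K := by
    refine (card_rpow_le hK.le (div_nonneg (by linarith) ha0.le)
      ((div_le_one ha0).2 (by linarith))).trans ?_
    gcongr
    exact div_le_self (by linarith) ha.le
  -- If N < D, then D - N ≤ (κ - 1) N ≤ (κ - 1) D.
  have hlow : D - N ≤ (κ - 1) * D := by
    rcases le_total D N with h | h
    · have h1κ : 1 ≤ κ := Real.one_le_rpow (by
        have : 1 ≤ Fintype.card Y := Fintype.card_pos
        rw [hKdef]; exact_mod_cast this) (div_nonneg (by linarith) ha0.le)
      nlinarith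
    · have h1κ : 1 ≤ κ := Real.one_le_rpow (by
        have : 1 ≤ Fintype.card Y := Fintype.card_pos
        rw [hKdef]; exact_mod_cast this) (div_nonneg (by linarith) ha0.le)
      nlinarith
  have hfin : (κ - 1) * D ≤ (a - 1) * (K * p) := by
    calc (κ - 1) * D ≤ ((a - 1) * K) * D := by gcongr; linarith
      _ ≤ ((a - 1) * K) * p := by gcongr
      _ = _ := by ring
  rw [abs_le]
  constructor <;> nlinarith

end Slice

/-- The limit of the conditional leakage as the order decreases to one. -/
theorem tendsto_leakage_one {U Y Z : Type*} [Fintype Y] [Nonempty Y] {q : Z → U → Y → ℝ}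
    (h0 : ∀ z u y, 0 ≤ q z u y) (hs : ∀ z, Summable fun u => ∑ y, q z u y)
    (hp : HasSum (fun z => ∑' u, ∑ y, q z u y) 1) :
    Tendsto (fun a : ℝ => a / (a - 1) * Real.log
      ((∑' z, ∑ y, (∑' u, q z u y ^ a) ^ (1 / a)) / ∑' z, (∑' u, (∑ y, q z u y) ^ a) ^ (1 / a)))
      (𝓝[>] 1)
      (𝓝 (∑' z, (massEntropy (fun y => ∑' u, q z u y) - ∑' u, massEntropy (q z u)))) := by
  have hn : ∀ z u, 0 ≤ ∑ y, q z u y := fun z u => Finset.sum_nonneg fun y _ => h0 z u y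
  have hpn : ∀ z, 0 ≤ ∑' u, ∑ y, q z u y := fun z => tsum_nonneg fun u => hn z u
  have hp1 : ∀ z, ∑' u, ∑ y, q z u y ≤ 1 := fun z => le_hasSum hp z fun z _ => hpn z
  set n : ℝ → Z → ℝ := fun a z => ∑ y, (∑' u, q z u y ^ a) ^ (1 / a) with hnn
  set d : ℝ → Z → ℝ := fun a z => (∑' u, (∑ y, q z u y) ^ a) ^ (1 / a) with hdd
  set I := ∑' z, (massEntropy (fun y => ∑' u, q z u y) - ∑' u, massEntropy (q z u)) with hI
  have hd0 : ∀ a z, 0 ≤ d a z := fun a z =>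
    Real.rpow_nonneg (tsum_nonneg fun u => Real.rpow_nonneg (hn z u) a) _
  have hbd : ∀ {a : ℝ}, 1 < a → ∀ z, d a z ≤ ∑' u, ∑ y, q z u y ∧
      |n a z - d a z| ≤ (a - 1) * (Fintype.card Y * ∑' u, ∑ y, q z u y) := fun ha z =>
    abs_slice_gain_sub_le (h0 z) (hs z) (hp1 z) ha
  have hdiff : Tendsto (fun a : ℝ => ∑' z, (n a z - d a z) / (a - 1)) (𝓝[>] 1) (𝓝 I) := by
    refine tendsto_tsum_of_dominated_convergence (hp.summable.mul_left (Fintype.card Y : ℝ))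
      (fun z => tendsto_slice_gain_sub_div (h0 z) (hs z) (hp1 z)) ?_
    filter_upwards [self_mem_nhdsWithin] with a ha z
    have hpos : 0 < a - 1 := sub_pos.2 ha
    rw [norm_div, Real.norm_of_nonneg hpos.le, div_le_iff₀ hpos, Real.norm_eq_abs]
    linarith [(hbd ha z).2]
  have hD : Tendsto (fun a : ℝ => ∑' z, d a z) (𝓝[>] 1) (𝓝 1) := by
    refine Eq.subst (motive := fun l => Tendsto _ _ (𝓝 l)) hp.tsum_eq ?_
    refine tendsto_tsum_of_dominated_convergence hp.summable (fun z => ?_) ?_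
    · have h1 := tendsto_tsum_rpow (hn z)
        (fun u => ((hs z).le_tsum u fun u _ => hn z u).trans (hp1 z)) (hs z)
      have h2 : Tendsto (fun a : ℝ => 1 / a) (𝓝[>] 1) (𝓝 1) := by
        have : Tendsto (fun a : ℝ => 1 / a) (𝓝 1) (𝓝 (1 / 1)) :=
          tendsto_const_nhds.div tendsto_id one_ne_zero
        rw [one_div_one] at this
        exact this.mono_left nhdsWithin_le_nhds
      simpa [hdd] using h1.rpow h2 (.inr one_pos)
    · filter_upwards [self_mem_nhdsWithin] with a ha z
      rw [Real.norm_of_nonneg (hd0 a z)]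
      exact (hbd ha z).1
  have hsub : ∀ {a : ℝ}, 1 < a → ∑' z, n a z = ∑' z, d a z
      + (a - 1) * ∑' z, (n a z - d a z) / (a - 1) := by
    intro a ha
    have hpos : 0 < a - 1 := sub_pos.2 ha
    have hds : Summable (d a) := hp.summable.of_nonneg_of_le (hd0 a) fun z => (hbd ha z).1
    have hnd : Summable fun z => n a z - d a z :=
      Summable.of_norm_bounded ((hp.summable.mul_left (Fintype.card Y : ℝ)).mul_left (a - 1))
        fun z => (hbd ha z).2
    rw [tsum_div_const, mul_div_cancel₀ _ hpos.ne', ← hds.tsum_add hnd]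
    exact tsum_congr fun z => by ring
  have ha0 : Tendsto (fun a : ℝ => a - 1) (𝓝[>] 1) (𝓝 0) := by
    have : Tendsto (fun a : ℝ => a - 1) (𝓝 1) (𝓝 (1 - 1)) := tendsto_id.sub_const 1
    rw [sub_self] at this
    exact this.mono_left nhdsWithin_le_nhds
  have ha1 : Tendsto (fun a : ℝ => a) (𝓝[>] 1) (𝓝 1) := tendsto_id.mono_left nhdsWithin_le_nhds
  have hN : Tendsto (fun a : ℝ => ∑' z, n a z) (𝓝[>] 1) (𝓝 1) := by
    have := hD.add (ha0.mul hdiff)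
    rw [zero_mul, add_zero] at this
    refine this.congr' ?_
    filter_upwards [self_mem_nhdsWithin] with a ha using (hsub ha).symm
  -- With N = D + (a - 1) r, the bounds 1 - D/N ≤ log (N/D) ≤ N/D - 1 enclose the leakage between a
  -- r / N and a r / D.
  have hlow := (ha1.mul hdiff).div hN one_ne_zero
  have hupp := (ha1.mul hdiff).div hD one_ne_zero
  rw [one_mul, div_one] at hlow hupp
  refine tendsto_of_tendsto_of_tendsto_of_le_of_le' hlow hupp ?_ ?_
  · filter_upwards [self_mem_nhdsWithin, hN.eventually (lt_mem_nhds one_pos),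
      hD.eventually (lt_mem_nhds one_pos)] with a ha hNp hDp
    have hpos : 0 < a - 1 := sub_pos.2 ha
    have haa : (0 : ℝ) < a := by linarith
    have h := hsub ha
    set N := ∑' z, n a z
    set D := ∑' z, d a z
    set r := ∑' z, (n a z - d a z) / (a - 1)
    have h1 := Real.one_sub_inv_le_log_of_pos (div_pos hNp hDp)
    calc a * r / N = a / (a - 1) * (1 - (N / D)⁻¹) := by
          rw [inv_div]; field_simp; rw [h]; ring
      _ ≤ _ := by gcongr
  · filter_upwards [self_mem_nhdsWithin, hN.eventually (lt_mem_nhds one_pos),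
      hD.eventually (lt_mem_nhds one_pos)] with a ha hNp hDp
    have hpos : 0 < a - 1 := sub_pos.2 ha
    have haa : (0 : ℝ) < a := by linarith
    have h := hsub ha
    set N := ∑' z, n a z
    set D := ∑' z, d a z
    set r := ∑' z, (n a z - d a z) / (a - 1)
    have h1 := Real.log_le_sub_one_of_pos (div_pos hNp hDp)
    calc _ ≤ a / (a - 1) * (N / D - 1) := by gcongr
      _ = a * r / D := by field_simp; rw [h]; ring

/-! ### Marginals as sums over fibres. -/

theorem map_apply_of_fiber {A B C : Type*} (Q : PMF A) (f : A → B) (b : B) (g : C → A)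
    (hg : Function.Injective g) (h : ∀ a, b = f a ↔ a ∈ Set.range g) :
    (Q.map f) b = ∑' c, Q (g c) := by
  classical
  rw [PMF.map_apply, ← hg.tsum_eq]
  · exact tsum_congr fun c => if_pos ((h _).2 ⟨c, rfl⟩)
  · intro a ha
    by_contra hn
    exact ha (if_neg (mt (h a).1 hn))

theorem map_drop_mid_apply {U Y Z : Type*} (Q : PMF (U × Y × Z)) (u : U) (z : Z) :
    (Q.map fun p => (p.1, p.2.2)) (u, z) = ∑' y, Q (u, y, z) :=
  map_apply_of_fiber Q _ _ (fun y => (u, y, z)) (fun y y' h => by simpa using h) <| by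
    rintro ⟨u', y', z'⟩; simp

theorem map_fst_apply {U Y : Type*} (Q : PMF (U × Y)) (u : U) :
    (Q.map Prod.fst) u = ∑' y, Q (u, y) :=
  map_apply_of_fiber Q _ _ (fun y => (u, y)) (fun y y' h => by simpa using h) <| by
    rintro ⟨u', y'⟩; simp

theorem map_snd_apply {U Y : Type*} (Q : PMF (U × Y)) (y : Y) :
    (Q.map Prod.snd) y = ∑' u, Q (u, y) :=
  map_apply_of_fiber Q _ _ (fun u => (u, y)) (fun y y' h => by simpa using h) <| by
    rintro ⟨u', y'⟩; simp [eq_comm]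

theorem map_drop_last_apply {X Y Z : Type*} (P : PMF (X × Y × Z)) (x : X) (y : Y) :
    (P.map fun p => (p.1, p.2.1)) (x, y) = ∑' z, P (x, y, z) :=
  map_apply_of_fiber P _ _ (fun z => (x, y, z)) (fun y y' h => by simpa using h) <| by
    rintro ⟨u', y', z'⟩; simp

theorem map_drop_second_apply {U X Y Z : Type*} (Q : PMF (U × X × Y × Z)) (u : U) (y : Y) (z : Z) :
    (Q.map fun p => (p.1, p.2.2.1, p.2.2.2)) (u, y, z) = ∑' x, Q (u, x, y, z) :=
  map_apply_of_fiber Q _ _ (fun x => (u, x, y, z)) (fun y y' h => by simpa using h) <| by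
    rintro ⟨u', x', y', z'⟩; simp

/-! ### The channel from X to Y and splittings of the law of X. -/

/-- The law of the first component of `P`. -/
noncomputable def marginal {X Y : Type*} (P : PMF (X × Y)) (x : X) : ℝ≥0∞ := ∑' y, P (x, y)

/-- The channel from the first to the second component of `P`. -/
noncomputable def channel {X Y : Type*} (P : PMF (X × Y)) (x : X) (y : Y) : ℝ≥0∞ :=
  P (x, y) / marginal P x

section Channel

variable {X Y : Type*} (P : PMF (X × Y))

theorem tsum_marginal : ∑' x, marginal P x = 1 := by
  rw [← P.tsum_coe, ENNReal.tsum_prod']; rfl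

theorem marginal_le_one (x : X) : marginal P x ≤ 1 :=
  (ENNReal.le_tsum x).trans (tsum_marginal P).le

theorem marginal_ne_top (x : X) : marginal P x ≠ ⊤ :=
  ne_top_of_le_ne_top ENNReal.one_ne_top (marginal_le_one P x)

theorem apply_eq_zero_of_marginal {x : X} (h : marginal P x = 0) (y : Y) : P (x, y) = 0 :=
  ENNReal.tsum_eq_zero.1 h y

theorem marginal_mul_channel (x : X) (y : Y) : marginal P x * channel P x y = P (x, y) := by
  rw [channel]
  by_cases h : marginal P x = 0
  · rw [h, zero_mul, apply_eq_zero_of_marginal P h]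
  · exact ENNReal.mul_div_cancel h (marginal_ne_top P x)

theorem tsum_channel {x : X} (h : marginal P x ≠ 0) : ∑' y, channel P x y = 1 := by
  simp only [channel, div_eq_mul_inv]
  rw [ENNReal.tsum_mul_right]
  exact ENNReal.mul_inv_cancel h (marginal_ne_top P x)

theorem channel_eq_zero {x : X} (h : marginal P x = 0) (y : Y) : channel P x y = 0 := by
  simp [channel, apply_eq_zero_of_marginal P h]

/-- The bound on `v` covers inputs of mass zero, where the channel row is zero rather than a
probability law. -/
theorem tsum_mul_channel {x : X} {v : ℝ≥0∞} (hv : v ≤ marginal P x) :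
    ∑' y, v * channel P x y = v := by
  rw [ENNReal.tsum_mul_left]
  by_cases h : marginal P x = 0
  · have : v = 0 := le_antisymm (h ▸ hv) bot_le
    rw [this, zero_mul]
  · rw [tsum_channel P h, mul_one]

/-- Every splitting of the law of `X` by a variable `U` yields, through the channel, an
admissible variable for the maximal leakage. -/
theorem exists_law_le_maxLeakage {U : Type} (V : U → X → ℝ≥0∞)
    (hV : ∀ x, ∑' u, V u x = marginal P x) :
    ∃ R : PMF (U × Y), (∀ u y, R (u, y) = ∑' x, V u x * channel P x y) ∧
      ∀ α, limUnder (orderFilter α) (leakageReal R) ≤ maxLeakage P α := by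
  have hVle : ∀ u x, V u x ≤ marginal P x := fun u x => hV x ▸ ENNReal.le_tsum u
  have hsum : ∀ x y, ∑' u, V u x * channel P x y = P (x, y) := fun x y => by
    rw [ENNReal.tsum_mul_right, hV, marginal_mul_channel]
  have htot : ∑' p : U × X × Y, V p.1 p.2.1 * channel P p.2.1 p.2.2 = 1 := by
    rw [ENNReal.tsum_prod', ENNReal.tsum_comm]
    simp_rw [ENNReal.tsum_prod', hsum]
    rw [← P.tsum_coe, ENNReal.tsum_prod']
  set Q : PMF (U × X × Y) := ⟨fun p => V p.1 p.2.1 * channel P p.2.1 p.2.2,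
    htot ▸ ENNReal.summable.hasSum⟩ with hQ
  have hQa : ∀ u x y, Q (u, x, y) = V u x * channel P x y := fun u x y => rfl
  have hQP : Q.map Prod.snd = P := by
    ext ⟨x, y⟩
    rw [map_snd_apply]
    simp_rw [hQa, hsum]
  have hM : IsMarkovChain Q := by
    intro u x y
    have h1 : (Q.map fun p => p.2) (x, y) = P (x, y) := by
      rw [show (Q.map fun p => p.2) = Q.map Prod.snd from rfl, hQP]
    have h2 : (Q.map fun p => p.2.1) x = marginal P x := by
      rw [show (fun p : U × X × Y => p.2.1) = Prod.fst ∘ Prod.snd from rfl, ← PMF.map_comp, hQP,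
        map_fst_apply, marginal]
    have h3 : (Q.map fun p => (p.1, p.2.1)) (u, x) = V u x := by
      rw [map_drop_last_apply]
      exact tsum_mul_channel P (hVle u x)
    rw [h1, h2, h3, hQa, mul_assoc, mul_comm (channel P x y), marginal_mul_channel]
  refine ⟨Q.map fun p => (p.1, p.2.2), fun u y => ?_, fun α => ?_⟩
  · rw [map_drop_mid_apply]
    simp_rw [hQa]
  · exact le_iSup_of_le U (le_iSup_of_le Q (le_iSup_of_le hQP (le_iSup_of_le hM le_rfl)))

end Channel

/-- Under the two Markov conditions the joint law factors through the channel. -/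
theorem apply_eq_mul_channel {U X Y Z : Type*} {P : PMF (X × Y × Z)}
    (hP : IsMarkovChain (P.map fun p => (p.2.2, p.1, p.2.1))) {Q : PMF (U × X × Y × Z)}
    (hQP : Q.map Prod.snd = P)
    (hQ : IsMarkovChain (Q.map fun p => (p.1, (p.2.1, p.2.2.2), p.2.2.1)))
    (u : U) (x : X) (y : Y) (z : Z) :
    Q (u, x, y, z) = (∑' y, Q (u, x, y, z)) * channel (P.map fun p => (p.1, p.2.1)) x y := by
  set P' := P.map fun p => (p.1, p.2.1) with hP'
  have e1 := hQ u (x, z) y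
  have e2 := hP z x y
  rw [PMF.map_comp, PMF.map_comp, PMF.map_comp] at e1 e2
  have a1 : (Q.map fun p => (p.1, (p.2.1, p.2.2.2), p.2.2.1)) (u, (x, z), y) = Q (u, x, y, z) := by
    rw [map_apply_of_fiber Q _ _ (fun _ : Unit => (u, x, y, z)) (fun _ _ _ => rfl)]
    · simp
    · rintro ⟨u', x', y', z'⟩; simp; tauto
  have a2 : (Q.map ((fun p => p.2.1) ∘ fun p : U × X × Y × Z =>
      (p.1, (p.2.1, p.2.2.2), p.2.2.1))) (x, z) = ∑' y, P (x, y, z) := by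
    rw [← map_drop_mid_apply, ← hQP, PMF.map_comp]; rfl
  have a3 : (Q.map ((fun p => (p.1, p.2.1)) ∘ fun p : U × X × Y × Z =>
      (p.1, (p.2.1, p.2.2.2), p.2.2.1))) (u, (x, z)) = ∑' y, Q (u, x, y, z) := by
    rw [map_apply_of_fiber Q _ _ (fun y => (u, x, y, z)) (fun y y' h => by simpa using h)]
    rintro ⟨u', x', y', z'⟩; simp
  have a4 : (Q.map ((fun p => p.2) ∘ fun p : U × X × Y × Z =>
      (p.1, (p.2.1, p.2.2.2), p.2.2.1))) ((x, z), y) = P (x, y, z) := by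
    rw [← hQP, map_snd_apply, map_apply_of_fiber Q _ _ (fun u => (u, x, y, z))
      (fun y y' h => by simpa using h)]
    rintro ⟨u', x', y', z'⟩; simp; tauto
  have b1 : (P.map fun p => (p.2.2, p.1, p.2.1)) (z, x, y) = P (x, y, z) := by
    rw [map_apply_of_fiber P _ _ (fun _ : Unit => (x, y, z)) (fun _ _ _ => rfl)]
    · simp
    · rintro ⟨x', y', z'⟩; simp; tauto
  have b2 : (P.map ((fun p => p.2.1) ∘ fun p : X × Y × Z => (p.2.2, p.1, p.2.1))) x
      = marginal P' x := by
    rw [marginal, ← map_fst_apply, hP', PMF.map_comp]; rfl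
  have b3 : (P.map ((fun p => (p.1, p.2.1)) ∘ fun p : X × Y × Z => (p.2.2, p.1, p.2.1))) (z, x)
      = ∑' y, P (x, y, z) := by
    rw [map_apply_of_fiber P _ _ (fun y => (x, y, z)) (fun y y' h => by simpa using h)]
    rintro ⟨x', y', z'⟩; simp; tauto
  have b4 : (P.map ((fun p => p.2) ∘ fun p : X × Y × Z => (p.2.2, p.1, p.2.1))) (x, y)
      = P' (x, y) := rfl
  rw [a1, a2, a3, a4] at e1
  rw [b1, b2, b3, b4] at e2
  set p := ∑' y, P (x, y, z) with hp
  have hpt : p ≠ ⊤ := by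
    rw [hp, ← map_drop_mid_apply]; exact PMF.apply_ne_top _ _
  have hQle : ∀ y, Q (u, x, y, z) ≤ P (x, y, z) := fun y => by
    rw [← hQP, map_snd_apply]; exact ENNReal.le_tsum (f := fun u => Q (u, x, y, z)) u
  by_cases h0 : p = 0
  · have hz : ∀ y, Q (u, x, y, z) = 0 := fun y =>
      le_antisymm ((hQle y).trans (ENNReal.tsum_eq_zero.1 h0 y).le) bot_le
    simp [hz]
  by_cases hm : marginal P' x = 0
  · have hp' : P' (x, y) = 0 := apply_eq_zero_of_marginal P' hm y
    have : P (x, y, z) = 0 := by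
      rw [hP', map_drop_last_apply] at hp'
      exact ENNReal.tsum_eq_zero.1 hp' z
    rw [channel_eq_zero P' hm, mul_zero]
    exact le_antisymm (this ▸ hQle y) bot_le
  -- The chain U - (X,Z) - Y gives Q p = V P(x,y,z), and Z - X - Y gives P(x,y,z) P(x) = p P(x,y).
  -- Combining them eliminates P(x,y,z); then p = P(x,z) and P(x) can be cancelled, both being
  -- nonzero here.
  have h3 : p * (marginal P' x * Q (u, x, y, z)) = p * ((∑' y, Q (u, x, y, z)) * P' (x, y)) := by
    calc _ = (Q (u, x, y, z) * p) * marginal P' x := by ring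
      _ = (∑' y, Q (u, x, y, z)) * (P (x, y, z) * marginal P' x) := by rw [e1]; ring
      _ = _ := by rw [e2]; ring
  have h4 := (ENNReal.mul_right_inj h0 hpt).1 h3
  rw [channel, ← mul_div_assoc, ← h4, mul_comm, ENNReal.mul_div_cancel_right hm
    (marginal_ne_top P' x)]

/-! ### Calculus of the `ℓ^a` norm. -/

section LpNorm

variable {U : Type*} {a : ℝ}

theorem lpNorm_mono (ha : 1 < a) {f g : U → ℝ≥0∞} (h : ∀ u, f u ≤ g u) :
    lpNorm a f ≤ lpNorm a g := by
  have h0 : 0 < a := by linarith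
  exact ENNReal.rpow_le_rpow (ENNReal.tsum_le_tsum fun u => ENNReal.rpow_le_rpow (h u) h0.le)
    (by positivity)

theorem lpNorm_const_mul (ha : 1 < a) (c : ℝ≥0∞) (f : U → ℝ≥0∞) :
    lpNorm a (fun u => c * f u) = c * lpNorm a f := by
  have h0 : 0 < a := by linarith
  simp only [lpNorm, ENNReal.mul_rpow_of_nonneg _ _ h0.le]
  rw [ENNReal.tsum_mul_left, ENNReal.mul_rpow_of_nonneg _ _ (by positivity), ← ENNReal.rpow_mul,
    mul_one_div_cancel h0.ne', ENNReal.rpow_one]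

theorem le_lpNorm (ha : 1 < a) (f : U → ℝ≥0∞) (u : U) : f u ≤ lpNorm a f := by
  have h0 : 0 < a := by linarith
  calc f u = (f u ^ a) ^ (1 / a) := by
        rw [← ENNReal.rpow_mul, mul_one_div_cancel h0.ne', ENNReal.rpow_one]
    _ ≤ lpNorm a f := ENNReal.rpow_le_rpow (ENNReal.le_tsum u) (by positivity)

theorem toReal_lpNorm (ha : 1 < a) {f : U → ℝ≥0∞} (hf : ∀ u, f u ≠ ⊤) :
    (lpNorm a f).toReal = (∑' u, (f u).toReal ^ a) ^ (1 / a) := by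
  rw [lpNorm, ← ENNReal.toReal_rpow, ENNReal.tsum_toReal_eq]
  · simp_rw [ENNReal.toReal_rpow]
  · exact fun u => ENNReal.rpow_ne_top_of_nonneg (by linarith) (hf u)

theorem lpNorm_ne_top_of_le_one (ha : 1 < a) {f : U → ℝ≥0∞} (hf : ∑' u, f u ≤ 1) :
    lpNorm a f ≠ ⊤ :=
  ENNReal.rpow_ne_top_of_nonneg (by have : 0 < a := by linarith
                                    positivity)
    (ne_top_of_le_ne_top ENNReal.one_ne_top
      ((tsum_rpow_le_tsum ha.le f fun u => (ENNReal.le_tsum u).trans hf).trans hf))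

end LpNorm

/-! ### Leakage in real terms, and its continuity in the order. -/

theorem mul_log_div_eq_coe {c : ℝ} {n d : ℝ≥0∞} (hn : n ≠ 0) (hn' : n ≠ ⊤) (hd : d ≠ 0)
    (hd' : d ≠ ⊤) :
    ((c : ℝ) : EReal) * ENNReal.log (n / d)
      = ((c * Real.log (n.toReal / d.toReal) : ℝ) : EReal) := by
  rw [ENNReal.log_pos_real (ENNReal.div_ne_zero.2 ⟨hn, hd'⟩) (ENNReal.div_ne_top hn' hd),
    ENNReal.toReal_div, EReal.coe_mul]

/-- Clears the logarithm and the quotient: what remains is linear in the two gains and can be summed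
over slices. -/
theorem mul_log_div_le_iff {c : ℝ} (hc : 0 < c) {n d : ℝ≥0∞} (hd : d ≠ 0) (hd' : d ≠ ⊤)
    (M : EReal) :
    ((c : ℝ) : EReal) * ENNReal.log (n / d) ≤ M ↔ n ≤ EReal.exp M ^ c⁻¹ * d := by
  rw [← ENNReal.log_rpow, ← ENNReal.div_le_iff_le_mul (.inl hd) (.inl hd'),
    ENNReal.le_rpow_inv_iff hc, ← ENNReal.log_le_log_iff (y := EReal.exp M), EReal.log_exp]

section Formulas

variable {U Y Z : Type*} {a : ℝ}

theorem sub_one_div_nonneg (ha : 1 < a) : 0 ≤ (a - 1) / a :=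
  div_nonneg (by linarith) (by linarith)

theorem div_sub_one_pos (ha : 1 < a) : 0 < a / (a - 1) :=
  div_pos (by linarith) (by linarith)

theorem condMaxGain_ne_top {S : Type*} (Q : PMF (U × S)) (ha : 1 < a) :
    condMaxGain Q ((a - 1) / a) ≠ ⊤ :=
  ne_top_of_le_ne_top ENNReal.one_ne_top (condMaxGain_le_one Q (sub_one_div_nonneg ha))

theorem maxGain_ne_top (Q : PMF U) (ha : 1 < a) : maxGain Q ((a - 1) / a) ≠ ⊤ :=
  ne_top_of_le_ne_top ENNReal.one_ne_top (maxGain_le_one Q (sub_one_div_nonneg ha))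

theorem leakageReal_eq_coe [Fintype Y] (Q : PMF (U × Y)) (ha : 1 < a) :
    leakageReal Q a = ((a / (a - 1) * Real.log
      ((∑ y, (∑' u, (Q (u, y)).toReal ^ a) ^ (1 / a))
        / (∑' u, (∑ y, (Q (u, y)).toReal) ^ a) ^ (1 / a)) : ℝ) : EReal) := by
  rw [leakageReal, mul_log_div_eq_coe (condMaxGain_pos _ _).ne' (condMaxGain_ne_top Q ha)
    (maxGain_pos _ _).ne' (maxGain_ne_top _ ha), condMaxGain_eq Q ha, maxGain_eq _ ha,
    tsum_fintype, ENNReal.toReal_sum fun y _ => lpNorm_ne_top_of_le_one ha (PMF_tsum_slice_le Q y),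
    toReal_lpNorm ha fun u => PMF.apply_ne_top _ _]
  simp_rw [toReal_lpNorm ha fun u => PMF.apply_ne_top Q _, map_fst_apply, tsum_fintype,
    ENNReal.toReal_sum fun y _ => PMF.apply_ne_top Q _]

theorem condLeakageReal_eq_coe [Fintype Y] (Q : PMF (U × Y × Z)) (ha : 1 < a) :
    condLeakageReal Q a = ((a / (a - 1) * Real.log
      ((∑' z, ∑ y, (∑' u, (Q (u, y, z)).toReal ^ a) ^ (1 / a))
        / ∑' z, (∑' u, (∑ y, (Q (u, y, z)).toReal) ^ a) ^ (1 / a)) : ℝ) : EReal) := by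
  have hl : ∀ s, lpNorm a (fun u => Q (u, s)) ≠ ⊤ := fun s =>
    lpNorm_ne_top_of_le_one ha (PMF_tsum_slice_le Q s)
  rw [condLeakageReal, mul_log_div_eq_coe (condMaxGain_pos _ _).ne' (condMaxGain_ne_top Q ha)
    (condMaxGain_pos _ _).ne' (condMaxGain_ne_top _ ha), condMaxGain_eq Q ha, condMaxGain_eq _ ha,
    ENNReal.tsum_prod', ENNReal.tsum_comm, ENNReal.tsum_toReal_eq, ENNReal.tsum_toReal_eq]
  · simp_rw [tsum_fintype, ENNReal.toReal_sum fun y (_ : y ∈ Finset.univ) => hl (y, _),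
      toReal_lpNorm ha fun u => PMF.apply_ne_top _ _, map_drop_mid_apply, tsum_fintype,
      ENNReal.toReal_sum fun y _ => PMF.apply_ne_top Q _]
  · exact fun z => lpNorm_ne_top_of_le_one ha (PMF_tsum_slice_le _ z)
  · intro z
    rw [tsum_fintype]
    exact ENNReal.sum_ne_top.2 fun y _ => hl (y, z)

end Formulas

theorem summable_toReal {A : Type*} (p : PMF A) : Summable fun u => (p u).toReal :=
  ENNReal.summable_toReal (by rw [p.tsum_coe]; exact ENNReal.one_ne_top)

theorem toReal_le_one {A : Type*} (p : PMF A) (u : A) : (p u).toReal ≤ 1 :=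
  ENNReal.toReal_le_of_le_ofReal zero_le_one (by simpa using p.coe_le_one u)

/-- Maximal leakage is defined by a limit even at interior orders; continuity in the order
identifies that limit with the value. -/
theorem limUnder_leakageReal {U Y : Type*} [Finite Y] (R : PMF (U × Y)) {α : ℝ≥0∞} (h1 : 1 < α)
    (ht : α < ⊤) : limUnder (orderFilter α) (leakageReal R) = leakageReal R α.toReal := by
  have := Fintype.ofFinite Y
  set a := α.toReal with ha
  have ha1 : 1 < a := by
    rw [ha, ← ENNReal.toReal_one]
    exact (ENNReal.toReal_lt_toReal ENNReal.one_ne_top ht.ne).2 h1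
  rw [orderFilter, if_neg ht.ne, ← ha]
  have hne : (𝓝[Set.Ioi 1 \ {a}] a).NeBot := by
    have h0 : (𝓝[>] a).NeBot := inferInstance
    refine h0.mono (nhdsWithin_mono a fun x hx => ?_)
    exact ⟨ha1.trans hx, ne_of_gt hx⟩
  refine Tendsto.limUnder_eq ?_
  have hr0 : ∀ u y, 0 ≤ (R (u, y)).toReal := fun u y => ENNReal.toReal_nonneg
  have hsumE : ∀ u, ∑ y, (R (u, y)).toReal = ((R.map Prod.fst) u).toReal := fun u => by
    rw [map_fst_apply, tsum_fintype, ENNReal.toReal_sum fun y _ => PMF.apply_ne_top R _]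
  have hcont : ∀ {A : Type _} {t : A → ℝ}, (∀ u, 0 ≤ t u) → (∀ u, t u ≤ 1) → Summable t →
      ContinuousAt (fun b : ℝ => (∑' u, t u ^ b) ^ (1 / b)) a := fun h0 h1 hs => by
    have hc := (continuousOn_tsum_rpow h0 h1 hs).continuousAt (Ici_mem_nhds ha1)
    exact hc.rpow (continuousAt_const.div continuousAt_id (by simp; linarith))
      (.inr (by positivity))
  have hnum : ContinuousAt (fun b : ℝ => ∑ y, (∑' u, (R (u, y)).toReal ^ b) ^ (1 / b)) a := by
    refine tendsto_finsetSum _ fun y _ => hcont (fun u => hr0 u y) (fun u => toReal_le_one R _) ?_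
    exact (summable_toReal R).comp_injective (Prod.mk_left_injective y)
  have hden : ContinuousAt (fun b : ℝ => (∑' u, (∑ y, (R (u, y)).toReal) ^ b) ^ (1 / b)) a := by
    simp_rw [hsumE]
    exact hcont (fun u => ENNReal.toReal_nonneg) (fun u => toReal_le_one _ u) (summable_toReal _)
  have hnum0 : ∑ y, (∑' u, (R (u, y)).toReal ^ a) ^ (1 / a) ≠ 0 := by
    have h := ENNReal.toReal_pos (condMaxGain_pos R _).ne' (condMaxGain_ne_top R ha1)
    rw [condMaxGain_eq R ha1, tsum_fintype, ENNReal.toReal_sum fun y _ =>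
      lpNorm_ne_top_of_le_one ha1 (PMF_tsum_slice_le R y)] at h
    simp_rw [toReal_lpNorm ha1 fun u => PMF.apply_ne_top R _] at h
    exact h.ne'
  have hden0 : (∑' u, (∑ y, (R (u, y)).toReal) ^ a) ^ (1 / a) ≠ 0 := by
    have h := ENNReal.toReal_pos (maxGain_pos (R.map Prod.fst) _).ne' (maxGain_ne_top _ ha1)
    rw [maxGain_eq _ ha1, toReal_lpNorm ha1 fun u => PMF.apply_ne_top _ _] at h
    simp_rw [← hsumE] at h
    exact h.ne'
  have hfin : ContinuousAt (fun b : ℝ => b / (b - 1) * Real.log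
      ((∑ y, (∑' u, (R (u, y)).toReal ^ b) ^ (1 / b))
        / (∑' u, (∑ y, (R (u, y)).toReal) ^ b) ^ (1 / b))) a :=
    (continuousAt_id.div (continuousAt_id.sub continuousAt_const) (by simp; linarith)).mul
      ((hnum.div hden hden0).log (div_ne_zero hnum0 hden0))
  rw [leakageReal_eq_coe R ha1]
  refine (((continuous_coe_real_ereal.tendsto _).comp hfin).mono_left
    nhdsWithin_le_nhds).congr' ?_
  filter_upwards [self_mem_nhdsWithin] with b hb
  rw [leakageReal_eq_coe R hb.1]; rfl

/-! ### Completing partial splittings with light symbols. -/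

section Fill

variable {X Y : Type*} (P : PMF (X × Y))

/-- A partial splitting of the law of `X`, completed by a uniform choice from `N + 1` further
symbols. -/
theorem exists_fill_law_le_maxLeakage {U : Type} (V : U → X → ℝ≥0∞)
    (hV : ∀ x, ∑' u, V u x ≤ marginal P x) (N : ℕ) :
    ∃ R : PMF ((U ⊕ Fin (N + 1)) × Y),
      (∀ u y, R (Sum.inl u, y) = ∑' x, V u x * channel P x y) ∧
      (∀ u, (R.map Prod.fst) (Sum.inl u) = ∑' x, V u x) ∧
      (∀ i, (R.map Prod.fst) (Sum.inr i) ≤ ((N + 1 : ℕ) : ℝ≥0∞)⁻¹) ∧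
      ∀ α, limUnder (orderFilter α) (leakageReal R) ≤ maxLeakage P α := by
  set V' : U ⊕ Fin (N + 1) → X → ℝ≥0∞ := fun s x => Sum.elim (fun u => V u x)
    (fun _ => (marginal P x - ∑' u, V u x) * ((N + 1 : ℕ) : ℝ≥0∞)⁻¹) s with hV'
  have hsum : ∀ x, ∑' s, V' s x = marginal P x := by
    intro x
    rw [ENNReal.summable.tsum_sum ENNReal.summable]
    simp only [hV', Sum.elim_inl, Sum.elim_inr, tsum_fintype, Finset.sum_const, Finset.card_univ,
      Fintype.card_fin, nsmul_eq_mul]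
    rw [mul_comm, mul_assoc, ENNReal.inv_mul_cancel (by simp) (ENNReal.natCast_ne_top _), mul_one,
      add_tsub_cancel_of_le (hV x)]
  obtain ⟨R, hR, hRle⟩ := exists_law_le_maxLeakage P V' hsum
  have hfst : ∀ s, (R.map Prod.fst) s = ∑' x, V' s x := fun s => by
    rw [map_fst_apply]
    simp_rw [hR]
    rw [ENNReal.tsum_comm]
    exact tsum_congr fun x => tsum_mul_channel P (hsum x ▸ ENNReal.le_tsum s)
  refine ⟨R, fun u y => hR _ _, fun u => hfst _, fun i => ?_, hRle⟩
  rw [hfst]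
  simp only [hV', Sum.elim_inr]
  rw [ENNReal.tsum_mul_right]
  refine mul_le_of_le_one_left' (le_trans (ENNReal.tsum_le_tsum fun x => ?_) (tsum_marginal P).le)
  exact tsub_le_self

/-- The total a-th power mass of the fillers is at most (N + 1)^(1-a). -/
theorem tendsto_mul_inv_rpow {a : ℝ} (ha : 1 < a) :
    Tendsto (fun N : ℕ => ((N + 1 : ℕ) : ℝ≥0∞) * (((N + 1 : ℕ) : ℝ≥0∞)⁻¹) ^ a) atTop (𝓝 0) := by
  have h : Tendsto (fun N : ℕ => (((N + 1 : ℕ) : ℝ≥0∞)⁻¹) ^ (a - 1)) atTop (𝓝 0) := by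
    have := (ENNReal.continuous_rpow_const (y := a - 1)).tendsto 0
    rw [ENNReal.zero_rpow_of_pos (by linarith)] at this
    exact this.comp (ENNReal.tendsto_inv_nat_nhds_zero.comp (tendsto_add_atTop_nat 1))
  refine h.congr fun N => ?_
  have h0 : ((N + 1 : ℕ) : ℝ≥0∞) ≠ 0 := by simp
  have ht : ((N + 1 : ℕ) : ℝ≥0∞) ≠ ⊤ := ENNReal.natCast_ne_top _
  conv_rhs => rw [show a = 1 + (a - 1) by ring]
  rw [ENNReal.rpow_add _ _ (ENNReal.inv_ne_zero.2 ht) (ENNReal.inv_ne_top.2 h0), ENNReal.rpow_one,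
    ← mul_assoc, ENNReal.mul_inv_cancel h0 ht, one_mul]

/-- A bound `C` on the gain ratio of all admissible variables also bounds the gain ratio of
every partial splitting. -/
theorem tsum_lpNorm_le_of_maxLeakage [Finite Y] {α : ℝ≥0∞} (h1 : 1 < α) (ht : α < ⊤)
    (hM : maxLeakage P α ≠ ⊤) {U : Type} (V : U → X → ℝ≥0∞)
    (hV : ∀ x, ∑' u, V u x ≤ marginal P x) :
    ∑' y, lpNorm α.toReal (fun u => ∑' x, V u x * channel P x y)
      ≤ EReal.exp (maxLeakage P α) ^ (α.toReal / (α.toReal - 1))⁻¹ *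
        lpNorm α.toReal (fun u => ∑' x, V u x) := by
  set a := α.toReal with ha
  have ha1 : 1 < a := by
    rw [ha, ← ENNReal.toReal_one]
    exact (ENNReal.toReal_lt_toReal ENNReal.one_ne_top ht.ne).2 h1
  have ha0 : 0 < a := by linarith
  set C := EReal.exp (maxLeakage P α) ^ (a / (a - 1))⁻¹ with hC
  have hCt : C ≠ ⊤ := ENNReal.rpow_ne_top_of_nonneg (inv_nonneg.2 (div_sub_one_pos ha1).le)
    (by rwa [Ne, EReal.exp_eq_top_iff])
  have hbound : ∀ N : ℕ, ∑' y, lpNorm a (fun u => ∑' x, V u x * channel P x y)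
      ≤ C * (∑' u, (∑' x, V u x) ^ a
        + ((N + 1 : ℕ) : ℝ≥0∞) * (((N + 1 : ℕ) : ℝ≥0∞)⁻¹) ^ a) ^ (1 / a) := by
    intro N
    obtain ⟨R, hR, hRl, hRr, hRle⟩ := exists_fill_law_le_maxLeakage P V hV N
    have h := hRle α
    rw [limUnder_leakageReal R h1 ht, leakageReal, mul_log_div_le_iff (div_sub_one_pos ha1)
      (maxGain_pos _ _).ne' (maxGain_ne_top _ ha1), condMaxGain_eq R ha1, maxGain_eq _ ha1] at h
    -- Fillers are dropped from the numerator and bounded in the denominator.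
    calc _ ≤ ∑' y, lpNorm a (fun s => R (s, y)) := by
          refine ENNReal.tsum_le_tsum fun y => ENNReal.rpow_le_rpow ?_ (by positivity)
          simp_rw [← hR]
          exact ENNReal.tsum_comp_le_tsum_of_injective Sum.inl_injective
            fun s => R (s, y) ^ a
      _ ≤ C * lpNorm a (R.map Prod.fst) := h
      _ ≤ _ := by
          gcongr
          refine ENNReal.rpow_le_rpow ?_ (by positivity)
          rw [ENNReal.summable.tsum_sum ENNReal.summable]
          simp only [hRl]
          gcongr
          rw [tsum_fintype]
          refine (Finset.sum_le_sum fun i _ => ENNReal.rpow_le_rpow (hRr i) ha0.le).trans ?_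
          simp
  -- As N → ∞ the filler term disappears; finiteness of `C` lets it multiply the limit.
  refine ge_of_tendsto' (x := atTop) ?_ hbound
  refine ENNReal.Tendsto.const_mul ?_ (.inr hCt)
  refine (ENNReal.continuous_rpow_const.tendsto _).comp ?_
  simpa using (tendsto_mul_inv_rpow ha1).const_add (∑' u, (∑' x, V u x) ^ a)

end Fill

/-! ### Slicewise bounds on the conditional leakage. -/

theorem tsum_tsum_eq_marginal {U X Y Z : Type*} {P : PMF (X × Y × Z)} {Q : PMF (U × X × Y × Z)}
    (hQP : Q.map Prod.snd = P) (x : X) :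
    ∑' z, ∑' u, ∑' y, Q (u, x, y, z) = marginal (P.map fun p => (p.1, p.2.1)) x := by
  simp_rw [marginal, map_drop_last_apply, ← hQP, map_snd_apply]
  rw [ENNReal.tsum_comm (f := fun y z => ∑' u, Q (u, x, y, z))]
  exact tsum_congr fun z => ENNReal.tsum_comm

section Converse

variable {U X Y Z : Type*} {P : PMF (X × Y × Z)} {Q : PMF (U × X × Y × Z)}

/-- The conditional leakage is bounded by the maximal leakage as soon as each slice of the joint
law is a partial splitting passed through the channel. -/
theorem condLeakageReal_le_of_slices {U : Type} {Y Z : Type*} [Finite Y] (P : PMF (X × Y))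
    (R : PMF (U × Y × Z)) (V : Z → U → X → ℝ≥0∞)
    (hV : ∀ z x, ∑' u, V z u x ≤ marginal P x)
    (hR : ∀ u y z, R (u, y, z) = ∑' x, V z u x * channel P x y)
    (hR' : ∀ u z, (R.map fun p => (p.1, p.2.2)) (u, z) = ∑' x, V z u x)
    {α : ℝ≥0∞} (h1 : 1 < α) (ht : α < ⊤) :
    condLeakageReal R α.toReal ≤ maxLeakage P α := by
  by_cases hM : maxLeakage P α = ⊤
  · rw [hM]; exact le_top
  have ha1 : 1 < α.toReal := by
    rw [← ENNReal.toReal_one]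
    exact (ENNReal.toReal_lt_toReal ENNReal.one_ne_top ht.ne).2 h1
  rw [condLeakageReal, mul_log_div_le_iff (div_sub_one_pos ha1)
      (condMaxGain_pos _ _).ne' (condMaxGain_ne_top _ ha1), condMaxGain_eq _ ha1,
      condMaxGain_eq _ ha1, ENNReal.tsum_prod', ENNReal.tsum_comm, ← ENNReal.tsum_mul_left]
  refine ENNReal.tsum_le_tsum fun z => ?_
  simp only [hR, hR']
  exact tsum_lpNorm_le_of_maxLeakage P h1 ht hM (V z) (hV z)

theorem map_drop_mid_map_drop_second_apply (u : U) (z : Z) :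
    ((Q.map fun p => (p.1, p.2.2.1, p.2.2.2)).map fun p => (p.1, p.2.2)) (u, z)
      = ∑' x, ∑' y, Q (u, x, y, z) := by
  rw [map_drop_mid_apply, ENNReal.tsum_comm]
  exact tsum_congr fun y => map_drop_second_apply Q u y z

theorem condLeakageReal_le_maxLeakage {U : Type} {Q : PMF (U × X × Y × Z)} [Finite Y]
    (hP : IsMarkovChain (P.map fun p => (p.2.2, p.1, p.2.1)))
    (hQP : Q.map Prod.snd = P)
    (hQ : IsMarkovChain (Q.map fun p => (p.1, (p.2.1, p.2.2.2), p.2.2.1)))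
    {α : ℝ≥0∞} (h1 : 1 < α) (ht : α < ⊤) :
    condLeakageReal (Q.map fun p => (p.1, p.2.2.1, p.2.2.2)) α.toReal
      ≤ maxLeakage (P.map fun p => (p.1, p.2.1)) α := by
  refine condLeakageReal_le_of_slices _ _ (fun z u x => ∑' y, Q (u, x, y, z)) (fun z x => ?_)
    (fun u y z => ?_) map_drop_mid_map_drop_second_apply h1 ht
  · rw [← tsum_tsum_eq_marginal hQP x]
    exact ENNReal.le_tsum (f := fun z => ∑' u, ∑' y, Q (u, x, y, z)) z
  · rw [map_drop_second_apply]
    exact tsum_congr fun x => apply_eq_mul_channel hP hQP hQ u x y z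

/-- Replacing W(y|x) by its supremum over x bounds each slice by a constant multiple of P(u,z), and
the norm is homogeneous. -/
theorem condLeakageReal_le_mul_log
    (hP : IsMarkovChain (P.map fun p => (p.2.2, p.1, p.2.1)))
    (hQP : Q.map Prod.snd = P)
    (hQ : IsMarkovChain (Q.map fun p => (p.1, (p.2.1, p.2.2.2), p.2.2.1)))
    {a : ℝ} (ha : 1 < a) :
    condLeakageReal (Q.map fun p => (p.1, p.2.2.1, p.2.2.2)) a
      ≤ ((a / (a - 1) : ℝ) : EReal) *
        ENNReal.log (∑' y, ⨆ x, channel (P.map fun p => (p.1, p.2.1)) x y) := by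
  rw [condLeakageReal]
  refine mul_le_mul_of_nonneg_left (ENNReal.log_monotone (ENNReal.div_le_of_le_mul ?_))
    (EReal.coe_nonneg.2 (div_sub_one_pos ha).le)
  rw [condMaxGain_eq _ ha, condMaxGain_eq _ ha, ENNReal.tsum_prod', ← ENNReal.tsum_mul_right]
  refine ENNReal.tsum_le_tsum fun y => ?_
  rw [← ENNReal.tsum_mul_left]
  refine ENNReal.tsum_le_tsum fun z => ?_
  rw [← lpNorm_const_mul ha]
  refine lpNorm_mono ha fun u => ?_
  rw [map_drop_second_apply, map_drop_mid_map_drop_second_apply, ← ENNReal.tsum_mul_left]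
  refine ENNReal.tsum_le_tsum fun x => ?_
  rw [apply_eq_mul_channel hP hQP hQ, mul_comm]
  gcongr
  exact le_iSup (fun x => channel (P.map fun p => (p.1, p.2.1)) x y) x

end Converse

/-! ### Order infinity. -/

theorem exists_pos_le_marginal {X Y : Type*} [Finite X] (P : PMF (X × Y)) :
    ∃ ε : ℝ≥0∞, ε ≠ 0 ∧ ε ≠ ⊤ ∧ ∀ x, marginal P x ≠ 0 → ε ≤ marginal P x := by
  classical
  have := Fintype.ofFinite X
  obtain ⟨p, -⟩ := P.support_nonempty
  have hX : Nonempty X := ⟨p.1⟩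
  -- Null inputs count as 1, which exceeds no attained minimum, since marginals are at most 1.
  obtain ⟨x, -, hx⟩ := Finset.exists_min_image Finset.univ
    (fun x => if marginal P x = 0 then 1 else marginal P x) Finset.univ_nonempty
  refine ⟨if marginal P x = 0 then 1 else marginal P x, ?_, ?_, fun x' hx' => ?_⟩
  · split_ifs with h
    · exact one_ne_zero
    · exact h
  · split_ifs with h
    · exact ENNReal.one_ne_top
    · exact marginal_ne_top P x
  · simpa [hx'] using hx x' (Finset.mem_univ _)

theorem tendsto_natCast_rpow_one_div {m : ℕ} (hm : m ≠ 0) :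
    Tendsto (fun a : ℝ => (m : ℝ≥0∞) ^ (1 / a)) atTop (𝓝 1) := by
  have hm' : (m : ℝ) ≠ 0 := by exact_mod_cast hm
  have h : Tendsto (fun a : ℝ => (m : ℝ) ^ (1 / a)) atTop (𝓝 1) := by
    have := (Real.continuous_const_rpow hm').tendsto 0
    rw [Real.rpow_zero] at this
    simp_rw [one_div]
    exact this.comp tendsto_inv_atTop_zero
  have h2 := ENNReal.tendsto_ofReal h
  rw [ENNReal.ofReal_one] at h2
  refine h2.congr fun a => ?_
  rw [← ENNReal.ofReal_rpow_of_pos (by positivity), ENNReal.ofReal_natCast]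

theorem tendsto_mul_log_of_tendsto {f : ℝ → ℝ≥0∞} {S : ℝ≥0∞} (hf : Tendsto f atTop (𝓝 S)) :
    Tendsto (fun a : ℝ => ((a / (a - 1) : ℝ) : EReal) * ENNReal.log (f a)) atTop
      (𝓝 (ENNReal.log S)) := by
  have := EReal.Tendsto.mul tendsto_div_sub_one_atTop ((ENNReal.continuous_log.tendsto _).comp hf)
    (.inl one_ne_zero) (.inl one_ne_zero) (.inl (EReal.coe_ne_bot 1)) (.inl (EReal.coe_ne_top 1))
  rwa [one_mul] at this

/-- Each non-null x gives one symbol a piece of mass ε, and all symbols have mass at most ε. With m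
symbols the denominator is at most ε m^(1/a), which tends to ε, while the largest entry for each y
makes the numerator at least ε Σ_y max_x W(y|x). -/
theorem log_iSup_channel_le_maxLeakage {X Y : Type*} [Finite X] [Finite Y] (P : PMF (X × Y)) :
    ENNReal.log (∑' y, ⨆ x, channel P x y) ≤ maxLeakage P ⊤ := by
  classical
  obtain ⟨ε, hε0, hεt, hε⟩ := exists_pos_le_marginal P
  -- The alphabet of U has to lie in `Type`, whereas X may live in any universe.
  obtain ⟨n, ⟨e⟩⟩ := Finite.exists_equiv_fin X
  obtain ⟨N, hN⟩ := ENNReal.exists_inv_nat_lt hε0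
  set V : Fin n → X → ℝ≥0∞ := fun i x => if x = e.symm i ∧ marginal P x ≠ 0 then ε else 0 with hV
  have hVsum : ∀ x, ∑' i, V i x ≤ marginal P x := by
    intro x
    rw [tsum_eq_single (e x)]
    · simp only [hV]
      split_ifs with h
      · exact hε x h.2
      · exact bot_le
    · intro i hi
      simp only [hV]
      rw [if_neg]
      rintro ⟨rfl, -⟩
      simp at hi
  have hVrow : ∀ i, ∑' x, V i x ≤ ε := by
    intro i
    rw [tsum_eq_single (e.symm i)]
    · simp only [hV]
      split_ifs <;> simp
    · intro x hx
      simp [hV, hx]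
  have hVch : ∀ i y, ∑' x, V i x * channel P x y = ε * channel P (e.symm i) y := by
    intro i y
    rw [tsum_eq_single (e.symm i)]
    · by_cases h : marginal P (e.symm i) = 0
      · simp [channel_eq_zero P h]
      · simp [hV, h]
    · intro x hx
      simp [hV, hx]
  obtain ⟨R, hR, hRl, hRr, hRle⟩ := exists_fill_law_le_maxLeakage P V hVsum N
  have hfst : ∀ s, (R.map Prod.fst) s ≤ ε := by
    rintro (i | i)
    · rw [hRl]; exact hVrow i
    · refine (hRr i).trans (le_trans ?_ hN.le)
      exact ENNReal.inv_le_inv.2 (by exact_mod_cast Nat.le_succ N)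
  obtain ⟨L, hL⟩ := exists_tendsto_leakageReal_atTop R
  have hlim : limUnder (orderFilter ⊤) (leakageReal R) = L := by
    rw [orderFilter, if_pos rfl]; exact hL.limUnder_eq
  refine le_trans ?_ (hlim ▸ hRle ⊤)
  set m : ℕ := Fintype.card (Fin n ⊕ Fin (N + 1)) with hm
  have hm0 : m ≠ 0 := by simp [hm]
  set S := ∑' y, ⨆ x, channel P x y with hS
  have hdiv : Tendsto (fun a : ℝ => S / (m : ℝ≥0∞) ^ (1 / a)) atTop (𝓝 S) := by
    have := ENNReal.Tendsto.div (tendsto_const_nhds (x := S) (f := atTop (α := ℝ)))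
      (.inr one_ne_zero) (tendsto_natCast_rpow_one_div hm0) (.inl ENNReal.one_ne_top)
    rwa [div_one] at this
  refine le_of_tendsto_of_tendsto (tendsto_mul_log_of_tendsto hdiv) hL ?_
  filter_upwards [eventually_gt_atTop 1] with a ha
  have ha0 : 0 < a := by linarith
  rw [leakageReal]
  refine mul_le_mul_of_nonneg_left (ENNReal.log_monotone ?_)
    (EReal.coe_nonneg.2 (div_sub_one_pos ha).le)
  have hden : maxGain (R.map Prod.fst) ((a - 1) / a) ≤ ε * (m : ℝ≥0∞) ^ (1 / a) := by
    rw [maxGain_eq _ ha]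
    refine (lpNorm_mono ha hfst).trans (le_of_eq ?_)
    have : lpNorm a (fun _ : Fin n ⊕ Fin (N + 1) => ε * 1) = ε * (m : ℝ≥0∞) ^ (1 / a) := by
      rw [lpNorm_const_mul ha]
      simp [lpNorm, hm]
    simpa using this
  have hnum : ε * S ≤ condMaxGain R ((a - 1) / a) := by
    rw [condMaxGain_eq _ ha, hS, ← ENNReal.tsum_mul_left]
    refine ENNReal.tsum_le_tsum fun y => ?_
    rw [ENNReal.mul_iSup]
    refine iSup_le fun x => ?_
    refine le_trans (le_of_eq ?_) (le_lpNorm ha (fun s => R (s, y)) (Sum.inl (e x)))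
    simp only [hR]
    rw [hVch, Equiv.symm_apply_apply]
  calc S / (m : ℝ≥0∞) ^ (1 / a) = ε * S / (ε * (m : ℝ≥0∞) ^ (1 / a)) :=
        (ENNReal.mul_div_mul_left _ _ hε0 hεt).symm
    _ ≤ _ := ENNReal.div_le_div hnum hden

theorem condLeakage_top_le_maxLeakage {U X Y Z : Type*} [Finite X] [Finite Y]
    {P : PMF (X × Y × Z)} {Q : PMF (U × X × Y × Z)}
    (hP : IsMarkovChain (P.map fun p => (p.2.2, p.1, p.2.1)))
    (hQP : Q.map Prod.snd = P)
    (hQ : IsMarkovChain (Q.map fun p => (p.1, (p.2.1, p.2.2.2), p.2.2.1))) :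
    condLeakage (Q.map fun p => (p.1, p.2.2.1, p.2.2.2)) ⊤
      ≤ maxLeakage (P.map fun p => (p.1, p.2.1)) ⊤ := by
  refine le_trans ?_ (log_iSup_channel_le_maxLeakage _)
  obtain ⟨L, hL⟩ := exists_tendsto_condLeakageReal_atTop
    (Q.map fun p => (p.1, p.2.2.1, p.2.2.2))
  rw [condLeakage, if_neg (by simp), orderFilter, if_pos rfl, hL.limUnder_eq]
  refine le_of_tendsto_of_tendsto hL (tendsto_mul_log_of_tendsto tendsto_const_nhds) ?_
  filter_upwards [eventually_gt_atTop 1] with a ha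
  exact condLeakageReal_le_mul_log hP hQP hQ ha

/-! ### Order one: mutual information. -/

theorem orderFilter_one : orderFilter 1 = 𝓝[>] 1 := by
  rw [orderFilter, if_neg ENNReal.one_ne_top, ENNReal.toReal_one, Set.sdiff_singleton_eq_self]
  simp

theorem tsum_sum_toReal {U Y : Type*} [Fintype Y] {f : U → Y → ℝ≥0∞} (hf : ∀ u y, f u y ≠ ⊤) :
    ∑' u, ∑ y, (f u y).toReal = (∑' u, ∑ y, f u y).toReal := by
  rw [ENNReal.tsum_toReal_eq fun u => ENNReal.sum_ne_top.2 fun y _ => hf u y]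
  simp_rw [ENNReal.toReal_sum fun y _ => hf _ y]

/-- The limit is I(U;Y|Z), written as H(Y|Z) - H(Y|U,Z) slice by slice. -/
theorem tendsto_condLeakageReal_one {U Y Z : Type*} [Fintype Y] (R : PMF (U × Y × Z)) :
    Tendsto (condLeakageReal R) (𝓝[>] 1)
      (𝓝 ((∑' z, (massEntropy (fun y => ∑' u, (R (u, y, z)).toReal)
        - ∑' u, massEntropy (fun y => (R (u, y, z)).toReal)) : ℝ) : EReal)) := by
  obtain ⟨r, -⟩ := R.support_nonempty
  have : Nonempty Y := ⟨r.2.1⟩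
  have htot : ∑' z, ∑' u, ∑ y, R (u, y, z) = 1 := by
    rw [← R.tsum_coe, ENNReal.tsum_prod', ENNReal.tsum_comm]
    refine tsum_congr fun u => ?_
    rw [ENNReal.tsum_prod', ENNReal.tsum_comm]
    exact tsum_congr fun z => (tsum_fintype _).symm
  have hlim := tendsto_leakage_one (q := fun z u y => (R (u, y, z)).toReal)
    (fun z u y => ENNReal.toReal_nonneg)
    (fun z => summable_sum fun y _ =>
      (summable_toReal R).comp_injective (Prod.mk_left_injective (y, z))) ?_
  · refine ((continuous_coe_real_ereal.tendsto _).comp hlim).congr' ?_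
    filter_upwards [self_mem_nhdsWithin] with a ha
    rw [condLeakageReal_eq_coe R ha]; rfl
  · have h := ENNReal.hasSum_toReal (f := fun z => ∑' u, ∑ y, R (u, y, z))
      (by rw [htot]; exact ENNReal.one_ne_top)
    rw [← ENNReal.tsum_toReal_eq, htot, ENNReal.toReal_one] at h
    · simpa only [tsum_sum_toReal fun u y => PMF.apply_ne_top R _] using h
    · exact fun z => ne_top_of_le_ne_top ENNReal.one_ne_top
        ((ENNReal.le_tsum (f := fun z => ∑' u, ∑ y, R (u, y, z)) z).trans htot.le)

theorem tendsto_leakageReal_one {U Y : Type*} [Fintype Y] (R : PMF (U × Y)) :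
    Tendsto (leakageReal R) (𝓝[>] 1)
      (𝓝 ((massEntropy (fun y => ∑' u, (R (u, y)).toReal)
        - ∑' u, massEntropy (fun y => (R (u, y)).toReal) : ℝ) : EReal)) := by
  obtain ⟨r, -⟩ := R.support_nonempty
  have : Nonempty Y := ⟨r.2⟩
  have htot : ∑' u, ∑ y, R (u, y) = 1 := by
    rw [← R.tsum_coe, ENNReal.tsum_prod']
    exact tsum_congr fun z => (tsum_fintype _).symm
  -- The unconditional case is a one-point Z.
  have hlim := tendsto_leakage_one (q := fun (_ : Unit) u y => (R (u, y)).toReal)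
    (fun z u y => ENNReal.toReal_nonneg)
    (fun z => summable_sum fun y _ =>
      (summable_toReal R).comp_injective (Prod.mk_left_injective y)) ?_
  · simp only [tsum_fintype (β := Unit), Finset.univ_unique, Finset.sum_singleton] at hlim
    refine ((continuous_coe_real_ereal.tendsto _).comp hlim).congr' ?_
    filter_upwards [self_mem_nhdsWithin] with a ha
    rw [leakageReal_eq_coe R ha]; rfl
  · rw [tsum_sum_toReal fun u y => PMF.apply_ne_top R _, htot]
    simp

/-- `I(U; Y | Z) ≤ I(X; Y)` when `Y` depends on `(U, X, Z)` only through the channel `w`. -/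
theorem tsum_massEntropy_sub_le {U X Y Z : Type*} [Fintype X] [Fintype Y] {v : Z → U → X → ℝ}
    {w : X → Y → ℝ} {m : X → ℝ} (hv : ∀ z u x, 0 ≤ v z u x) (hw : ∀ x y, 0 ≤ w x y)
    (hs : ∀ z x, Summable fun u => v z u x) (hm : ∀ x, HasSum (fun z => ∑' u, v z u x) (m x)) :
    ∑' z, (massEntropy (fun y => ∑' u, ∑ x, v z u x * w x y)
        - ∑' u, massEntropy (fun y => ∑ x, v z u x * w x y))
      ≤ massEntropy (fun y => ∑ x, m x * w x y) - ∑ x, m x * massEntropy (w x) := by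
  have hq0 : ∀ z u y, 0 ≤ ∑ x, v z u x * w x y := fun z u y =>
    Finset.sum_nonneg fun x _ => mul_nonneg (hv z u x) (hw x y)
  have hqu : ∀ z y, HasSum (fun u => ∑ x, v z u x * w x y) (∑ x, (∑' u, v z u x) * w x y) :=
    fun z y => hasSum_sum fun x _ => (hs z x).hasSum.mul_right _
  have hqz : ∀ y, HasSum (fun z => ∑' u, ∑ x, v z u x * w x y) (∑ x, m x * w x y) := fun y => by
    simp_rw [fun z => (hqu z y).tsum_eq]
    exact hasSum_sum fun x _ => (hm x).mul_right _
  -- Superadditivity over z is H(Y|Z) ≤ H(Y).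
  obtain ⟨hsz, hlez⟩ := summable_and_tsum_massEntropy_le
    (fun z y => tsum_nonneg fun u => hq0 z u y) hqz
  have hu := fun z => summable_and_tsum_massEntropy_le (fun u y => hq0 z u y) fun y => (hqu z y)
  have hsg : Summable fun z => ∑' u, massEntropy (fun y => ∑ x, v z u x * w x y) := by
    refine hsz.of_nonneg_of_le (fun z => tsum_nonneg fun u => massEntropy_nonneg (hq0 z u))
      fun z => ?_
    simp_rw [fun y => (hqu z y).tsum_eq]
    exact (hu z).2
  -- Superadditivity over x, which sums to H(Y|X) ≤ H(Y|U,Z).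
  have hx : ∀ z u, ∑ x, v z u x * massEntropy (w x)
      ≤ massEntropy (fun y => ∑ x, v z u x * w x y) := by
    intro z u
    have h := (summable_and_tsum_massEntropy_le (w := fun x y => v z u x * w x y)
      (fun x y => mul_nonneg (hv z u x) (hw x y)) fun y => hasSum_fintype _).2
    simpa only [massEntropy_smul, tsum_fintype] using h
  have hlow : ∑ x, m x * massEntropy (w x)
      ≤ ∑' z, ∑' u, massEntropy (fun y => ∑ x, v z u x * w x y) := by
    have h1 : HasSum (fun z => ∑ x, (∑' u, v z u x) * massEntropy (w x))
        (∑ x, m x * massEntropy (w x)) := hasSum_sum fun x _ => (hm x).mul_right _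
    rw [← h1.tsum_eq]
    refine h1.summable.tsum_le_tsum (fun z => ?_) hsg
    have h2 : HasSum (fun u => ∑ x, v z u x * massEntropy (w x))
        (∑ x, (∑' u, v z u x) * massEntropy (w x)) :=
      hasSum_sum fun x _ => (hs z x).hasSum.mul_right _
    rw [← h2.tsum_eq]
    exact h2.summable.tsum_le_tsum (hx z) (hu z).1
  rw [hsz.tsum_sub hsg]
  linarith

/-- Take U = X, relabelled by `Fin n` so that its alphabet lies in `Type`. -/
theorem mutualInformation_le_maxLeakage {X Y : Type*} [Fintype X] [Fintype Y] (P : PMF (X × Y)) :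
    ((massEntropy (fun y => ∑ x, (P (x, y)).toReal)
      - ∑ x, massEntropy (fun y => (P (x, y)).toReal) : ℝ) : EReal) ≤ maxLeakage P 1 := by
  classical
  obtain ⟨n, ⟨e⟩⟩ := Finite.exists_equiv_fin X
  have hV : ∀ x, ∑' i, (if x = e.symm i then marginal P x else 0) = marginal P x := by
    intro x
    rw [tsum_eq_single (e x)]
    · simp
    · intro i hi
      rw [if_neg]
      rintro rfl
      simp at hi
  obtain ⟨R, hR, hRle⟩ := exists_law_le_maxLeakage P _ hV
  have hRP : ∀ i y, R (i, y) = P (e.symm i, y) := by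
    intro i y
    rw [hR, tsum_eq_single (e.symm i) fun x hx => by simp [hx], if_pos rfl, marginal_mul_channel]
  have h := tendsto_leakageReal_one R
  simp only [hRP, tsum_fintype] at h
  have hle := hRle 1
  rw [orderFilter_one, Tendsto.limUnder_eq h] at hle
  have e1 : ∀ f : X → ℝ, ∑ i, f (e.symm i) = ∑ x, f x := fun f => Equiv.sum_comp e.symm f
  rw [e1 fun x => massEntropy fun y => (P (x, y)).toReal] at hle
  simpa only [fun y => e1 fun x => (P (x, y)).toReal] using hle

theorem condLeakage_one_le_maxLeakage {U X Y Z : Type*} [Finite X] [Finite Y]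
    {P : PMF (X × Y × Z)} {Q : PMF (U × X × Y × Z)}
    (hP : IsMarkovChain (P.map fun p => (p.2.2, p.1, p.2.1)))
    (hQP : Q.map Prod.snd = P)
    (hQ : IsMarkovChain (Q.map fun p => (p.1, (p.2.1, p.2.2.2), p.2.2.1))) :
    condLeakage (Q.map fun p => (p.1, p.2.2.1, p.2.2.2)) 1
      ≤ maxLeakage (P.map fun p => (p.1, p.2.1)) 1 := by
  have := Fintype.ofFinite X
  have := Fintype.ofFinite Y
  refine le_trans ?_ (mutualInformation_le_maxLeakage _)
  rw [condLeakage, if_neg (by simp), orderFilter_one,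
    (tendsto_condLeakageReal_one _).limUnder_eq, EReal.coe_le_coe_iff]
  have hfac := apply_eq_mul_channel hP hQP hQ
  have hmarg := tsum_tsum_eq_marginal hQP
  generalize P.map (fun p => (p.1, p.2.1)) = P' at *
  have hslice : ∀ z x, ∑' u, ∑' y, Q (u, x, y, z) ≤ marginal P' x := fun z x => by
    rw [← hmarg x]
    exact ENNReal.le_tsum (f := fun z => ∑' u, ∑' y, Q (u, x, y, z)) z
  have hslice' : ∀ z x, ∑' u, ∑' y, Q (u, x, y, z) ≠ ⊤ := fun z x =>
    ne_top_of_le_ne_top (marginal_ne_top P' x) (hslice z x)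
  have hentry : ∀ z u x, ∑' y, Q (u, x, y, z) ≠ ⊤ := fun z u x =>
    ne_top_of_le_ne_top (hslice' z x) (ENNReal.le_tsum (f := fun u => ∑' y, Q (u, x, y, z)) u)
  have key := tsum_massEntropy_sub_le (v := fun z u x => (∑' y, Q (u, x, y, z)).toReal)
    (w := fun x y => (channel P' x y).toReal) (m := fun x => (marginal P' x).toReal)
    (fun z u x => ENNReal.toReal_nonneg) (fun x y => ENNReal.toReal_nonneg)
    (fun z x => ENNReal.summable_toReal (hslice' z x)) (fun x => by
      have h := ENNReal.hasSum_toReal (f := fun z => ∑' u, ∑' y, Q (u, x, y, z))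
        (by rw [hmarg]; exact marginal_ne_top P' x)
      rw [← ENNReal.tsum_toReal_eq fun z => hslice' z x, hmarg] at h
      simpa only [ENNReal.tsum_toReal_eq fun u => hentry _ u x] using h)
  have hQ' : ∀ u y z, ((Q.map fun p => (p.1, p.2.2.1, p.2.2.2)) (u, y, z)).toReal
      = ∑ x, (∑' y, Q (u, x, y, z)).toReal * (channel P' x y).toReal := fun u y z => by
    rw [map_drop_second_apply, tsum_fintype, ENNReal.toReal_sum fun x _ => PMF.apply_ne_top Q _]
    exact Finset.sum_congr rfl fun x _ => by rw [hfac, ENNReal.toReal_mul]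
  have hP' : ∀ x y, (marginal P' x).toReal * (channel P' x y).toReal = (P' (x, y)).toReal :=
    fun x y => by rw [← ENNReal.toReal_mul, marginal_mul_channel]
  simp only [← massEntropy_smul, hP'] at key
  simpa only [hQ'] using key

end AlphaLeakage

theorem theorem3 {X Y Z : Type*} [Finite X] [Finite Y] (P : PMF (X × Y × Z))
    (hMarkov : AlphaLeakage.IsMarkovChain (P.map fun p => (p.2.2, p.1, p.2.1)))
    (α : ℝ≥0∞) (hα : 1 ≤ α) :
    AlphaLeakage.condMaxLeakage P α
      ≤ AlphaLeakage.maxLeakage (P.map fun p => (p.1, p.2.1)) α := by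
  refine iSup_le fun U => iSup_le fun Q => iSup_le fun hQP => iSup_le fun hQ => ?_
  rcases hα.eq_or_lt with rfl | h1
  · exact AlphaLeakage.condLeakage_one_le_maxLeakage hMarkov hQP hQ
  rcases eq_or_ne α ⊤ with rfl | ht
  · exact AlphaLeakage.condLeakage_top_le_maxLeakage hMarkov hQP hQ
  · rw [AlphaLeakage.condLeakage, if_pos ⟨h1, ht.lt_top⟩]
    exact AlphaLeakage.condLeakageReal_le_maxLeakage hMarkov hQP hQ h1 ht.lt_top
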